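/- Let $N\ge 1$, let $\alpha_0=0$ and $\alpha_1,\dots,\alpha_N\in\mathbb R$, and let $R(z)=\sum_{k=0}^{N}\alpha_k z^{-k}$. Let $A\in\mathbb R^{N\times N}$ be the matrix with ones on the first superdiagonal and zeros elsewhere, $B=[0,\dots,0,1]^\top\in\mathbb R^{N\times 1}$ and $C(\alpha)=[\alpha_N,\alpha_{N-1},\dots,\alpha_1]$. Let $\omega_0\in(0,\pi)$, $\Omega>0$ with $[\omega_0-\Omega,\omega_0+\Omega]\subset[0,\pi]$, and let $\gamma>0$. Then $$\max_{\omega\in[\omega_0-\Omega,\,\omega_0+\Omega]}\bigl|1+R(e^{j\omega})\bigr|<\gamma$$ if and only if there exist real symmetric matrices $X,Y\in\mathbb R^{N\times N}$ with $Y>0$ (positive definite) such that the complex Hermitian matrix below is negative definite: $$\begin{bmatrix} M_4 & M_5 & C(\alpha)^\top\\ \overline{M}_5^{\,\top} & M_6 & 1\\ C(\alpha) & 1 & -1\end{bmatrix}<0,$$ where $$\begin{aligned} M_4&=A^\top XA+YA\,e^{-j\omega_0}+A^\top Y\,e^{j\omega_0}-X-2Y\cos\Omega,\\ M_5&=A^\top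 XB+YB\,e^{-j\omega_0},\qquad \overline{M}_5=A^\top XB+YB\,e^{j\omega_0},\\ M_6&=B^\top XB-\gamma^2.\end{aligned}$$ -/

import Mathlib

noncomputable section

/-- The FIR filter `R(z) = ∑_{k=0}^{N} α_k z^{-k}`. -/
def firFilter {N : ℕ} (α : Fin (N + 1) → ℝ) (z : ℂ) : ℂ :=
  ∑ k : Fin (N + 1), (α k : ℂ) * z⁻¹ ^ (k : ℕ)

/-- The noise transfer function `T_NTF(z) = 1 + R(z)`. -/
def ntf {N : ℕ} (α : Fin (N + 1) → ℝ) (z : ℂ) : ℂ :=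
  1 + firFilter α z

/-- The worst-case measure `max_{ω ∈ I} |T(e^{jω})|` of `T` over the frequency band `I`
(the maximum is attained in the case of interest, see `isGreatest_worstCase_ntf`). -/
def worstCase (T : ℂ → ℂ) (I : Set ℝ) : ℝ :=
  sSup ((fun ω : ℝ => ‖T (Complex.exp (Complex.I * ω))‖) '' I)

/-- On a nonempty compact band, `worstCase` of the noise transfer function is a maximum. -/
theorem isGreatest_worstCase_ntf {N : ℕ} (α : Fin (N + 1) → ℝ) (I : Set ℝ)
    (hI : IsCompact I) (hne : I.Nonempty) :
    IsGreatest ((fun ω : ℝ => ‖ntf α (Complex.exp (Complex.I * ω))‖) '' I)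
      (worstCase (ntf α) I) := by
  have hc : Continuous fun ω : ℝ => ‖ntf α (Complex.exp (Complex.I * ω))‖ := by
    unfold ntf firFilter
    simp only [← Complex.exp_neg]
    fun_prop
  exact (hI.image hc).isGreatest_sSup (hne.image _)

/-- The `N × N` shift matrix: ones on the first superdiagonal and zeros elsewhere. -/
def matA (N : ℕ) : Matrix (Fin N) (Fin N) ℝ :=
  Matrix.of fun i j => if (i : ℕ) + 1 = (j : ℕ) then 1 else 0

/-- The column `[0, …, 0, 1]ᵀ` of height `N`. -/
def matB (N : ℕ) : Matrix (Fin N) (Fin 1) ℝ :=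
  Matrix.of fun i _ => if (i : ℕ) + 1 = N then 1 else 0

/-- The row `C(α) = [α_N, α_{N-1}, …, α_1]`. -/
def matC {N : ℕ} (α : Fin (N + 1) → ℝ) : Matrix (Fin 1) (Fin N) ℝ :=
  Matrix.of fun _ i => α ⟨N - (i : ℕ), by omega⟩

/-- A real matrix regarded as a complex one. -/
def cplx {m n : Type*} (M : Matrix m n ℝ) : Matrix m n ℂ :=
  M.map (fun x : ℝ => (x : ℂ))

/-- `M₄ = Aᵀ X A + Y A e^{-jω₀} + Aᵀ Y e^{jω₀} - X - 2 Y cos Ω`. -/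
def matM4 {N : ℕ} (X Y : Matrix (Fin N) (Fin N) ℝ) (ω₀ Ω : ℝ) : Matrix (Fin N) (Fin N) ℂ :=
  cplx ((matA N).transpose * X * matA N)
    + Complex.exp (-(Complex.I * ω₀)) • cplx (Y * matA N)
    + Complex.exp (Complex.I * ω₀) • cplx ((matA N).transpose * Y)
    - cplx X - cplx ((2 * Real.cos Ω) • Y)

/-- `M₅ = Aᵀ X B + Y B e^{-jω₀}`. -/
def matM5 {N : ℕ} (X Y : Matrix (Fin N) (Fin N) ℝ) (ω₀ : ℝ) : Matrix (Fin N) (Fin 1) ℂ :=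
  cplx ((matA N).transpose * X * matB N)
    + Complex.exp (-(Complex.I * ω₀)) • cplx (Y * matB N)

/-- `M̄₅ = Aᵀ X B + Y B e^{jω₀}`. -/
def matM5bar {N : ℕ} (X Y : Matrix (Fin N) (Fin N) ℝ) (ω₀ : ℝ) : Matrix (Fin N) (Fin 1) ℂ :=
  cplx ((matA N).transpose * X * matB N)
    + Complex.exp (Complex.I * ω₀) • cplx (Y * matB N)

/-- `M₆ = Bᵀ X B - g` as a `1 × 1` matrix; it is used with `g = γ²`. -/
def matM6 {N : ℕ} (X : Matrix (Fin N) (Fin N) ℝ) (g : ℝ) : Matrix (Fin 1) (Fin 1) ℂ :=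
  cplx ((matB N).transpose * X * matB N - g • (1 : Matrix (Fin 1) (Fin 1) ℝ))

/-- The block matrix `[[M₄, M₅, C(α)ᵀ], [M̄₅ᵀ, M₆, 1], [C(α), 1, -1]]`. -/
def lmiMatrix {N : ℕ} (α : Fin (N + 1) → ℝ) (X Y : Matrix (Fin N) (Fin N) ℝ) (ω₀ Ω γ : ℝ) :
    Matrix ((Fin N ⊕ Fin 1) ⊕ Fin 1) ((Fin N ⊕ Fin 1) ⊕ Fin 1) ℂ :=
  Matrix.fromBlocks
    (Matrix.fromBlocks (matM4 X Y ω₀ Ω) (matM5 X Y ω₀)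
      (matM5bar X Y ω₀).transpose (matM6 X (γ ^ 2)))
    (Matrix.fromRows (cplx (matC α).transpose) 1)
    (Matrix.fromCols (cplx (matC α)) 1)
    (-1)

open scoped ComplexOrder in
/-- `M < 0`: the complex matrix `M` is Hermitian and negative definite. -/
def NegDef {n : Type*} [Fintype n] (M : Matrix n n ℂ) : Prop :=
  (-M).PosDef

end

/-! Write w₋ and w₊ for a vector w ∈ ℂ^{N+1} without its last, respectively first, entry. A Schur
complement in the corner -1, together with A w₋ + B w_N = w₊, turns the matrix inequality into
negativity for w ≠ 0 of `lmiForm`: w₊ᴴXw₊ - w₋ᴴXw₋ + `bandForm` - γ²|w_N|² + |v·w|², where v lists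
the coefficients of z^N(1 + R(z)) (`negDef_lmiMatrix_iff`).

LMI ⇒ bound: at w = (1, z, …, z^N), |z| = 1, one has w₊ = z w₋. The X terms cancel and the Y term is
2(cos(ω - ω₀) - cos Ω) w₋ᴴYw₋, which is nonnegative on the band, so |1 + R| < γ there.

Bound ⇒ LMI: γ² - |1 + R|² is the symbol of a symmetric matrix T, hence p(cos ω) with deg p ≤ N
(`exists_symbol_polynomial`). A positive constant ε can be subtracted from p with positivity kept on
[cos(ω₀ + Ω), cos(ω₀ - Ω)]. By Lukács' theorem (`mem_intervalCone_of_pos`) p - ε is a sum of terms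
(X - A)^i (B - X)^j f². Each has an explicit certificate (`bandCert_of_mem_intervalCone`): a matrix
Θ with that symbol and Y ≥ 0 such that Θ - `bandForm` is a nonnegative form on all of ℂ^{N+1}. With
δ(N + 1) = ε, the matrix T - Θ - δI has zero symbol, so it has the form w₋ᴴXw₋ - w₊ᴴXw₊
(`exists_displacement`). This supplies the multiplier X, and the slack δI pays for strictness and
for making Y definite. -/

noncomputable section

/-! ### Polynomials positive on an interval -/

open Polynomial in
/-- The products `(X - A)^i (B - X)^j f²` of degree at most `n`. -/
def intervalSquares (A B : ℝ) (n : ℕ) : Set ℝ[X] :=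
  {p | ∃ (i j : ℕ) (f : ℝ[X]), i + j + 2 * f.natDegree ≤ n ∧
    p = (X - C A) ^ i * (C B - X) ^ j * f ^ 2}

open Polynomial in
/-- The cone of sums of products `(X - A)^i (B - X)^j f²` of degree at most `n`. -/
def intervalCone (A B : ℝ) (n : ℕ) : AddSubmonoid ℝ[X] :=
  AddSubmonoid.closure (intervalSquares A B n)

section Cone

open Polynomial

variable {A B : ℝ}

theorem intervalCone_mono {m n : ℕ} (h : m ≤ n) : intervalCone A B m ≤ intervalCone A B n := by
  apply AddSubmonoid.closure_mono
  rintro p ⟨i, j, f, hd, rfl⟩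
  exact ⟨i, j, f, hd.trans h, rfl⟩

theorem mul_mem_intervalCone {m n : ℕ} {q : ℝ[X]}
    (hq : ∀ p ∈ intervalSquares A B m, q * p ∈ intervalCone A B n) {p : ℝ[X]}
    (hp : p ∈ intervalCone A B m) : q * p ∈ intervalCone A B n := by
  induction hp using AddSubmonoid.closure_induction with
  | mem x hx => exact hq x hx
  | zero => simp
  | add x y _ _ hx hy => rw [mul_add]; exact add_mem hx hy

theorem X_sub_C_mul_mem_intervalCone {n : ℕ} {p : ℝ[X]} (hp : p ∈ intervalCone A B n) :
    (X - C A) * p ∈ intervalCone A B (n + 1) := by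
  refine mul_mem_intervalCone ?_ hp
  rintro p ⟨i, j, f, hd, rfl⟩
  exact AddSubmonoid.subset_closure ⟨i + 1, j, f, by omega, by ring⟩

theorem C_sub_X_mul_mem_intervalCone {n : ℕ} {p : ℝ[X]} (hp : p ∈ intervalCone A B n) :
    (C B - X) * p ∈ intervalCone A B (n + 1) := by
  refine mul_mem_intervalCone ?_ hp
  rintro p ⟨i, j, f, hd, rfl⟩
  exact AddSubmonoid.subset_closure ⟨i, j + 1, f, by omega, by ring⟩

theorem sq_mul_mem_intervalCone {n d : ℕ} {p q : ℝ[X]} (hq : q.natDegree ≤ d)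
    (hp : p ∈ intervalCone A B n) : q ^ 2 * p ∈ intervalCone A B (n + 2 * d) := by
  refine mul_mem_intervalCone ?_ hp
  rintro p ⟨i, j, f, hd, rfl⟩
  refine AddSubmonoid.subset_closure ⟨i, j, q * f, ?_, by ring⟩
  have := natDegree_mul_le (p := q) (q := f)
  omega

theorem C_mul_mem_intervalCone {n : ℕ} {p : ℝ[X]} {c : ℝ} (hc : 0 ≤ c)
    (hp : p ∈ intervalCone A B n) : C c * p ∈ intervalCone A B n := by
  have := sq_mul_mem_intervalCone (d := 0) (q := C √c) (by simp) hp
  rwa [← C_pow, Real.sq_sqrt hc] at this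

theorem C_mem_intervalCone {n : ℕ} {c : ℝ} (hc : 0 ≤ c) : C c ∈ intervalCone A B n := by
  have h1 : (1 : ℝ[X]) ∈ intervalCone A B n :=
    AddSubmonoid.subset_closure ⟨0, 0, 1, by simp, by simp⟩
  simpa using C_mul_mem_intervalCone hc h1

/-- Linear interpolation between the end points writes q as a combination of X - A and B - X with
weights q(B)/(B - A) and q(A)/(B - A), both nonnegative. -/
theorem linear_mul_mem_intervalCone (hAB : A < B) {n : ℕ} {p q : ℝ[X]} (hq : q.natDegree ≤ 1)
    (hA : 0 ≤ q.eval A) (hB : 0 ≤ q.eval B) (hp : p ∈ intervalCone A B n) :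
    q * p ∈ intervalCone A B (n + 1) := by
  have hne : B - A ≠ 0 := (sub_pos.2 hAB).ne'
  obtain ⟨a, b, rfl⟩ : ∃ a b, q = C a * X + C b :=
    ⟨_, _, eq_X_add_C_of_natDegree_le_one hq⟩
  simp only [eval_add, eval_mul, eval_C, eval_X] at hA hB
  have key : (C a * X + C b) * p =
      C ((a * B + b) / (B - A)) * ((X - C A) * p) + C ((a * A + b) / (B - A)) * ((C B - X) * p) := by
    have h1 : (C ((a * B + b) / (B - A)) * (X - C A) + C ((a * A + b) / (B - A)) * (C B - X) : ℝ[X])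
        = C a * X + C b := by
      refine funext fun x => ?_
      simp only [eval_add, eval_sub, eval_mul, eval_C, eval_X]
      field_simp
      ring
    rw [← h1]; ring
  rw [key]
  have hpos := (sub_pos.2 hAB).le
  exact add_mem
    (C_mul_mem_intervalCone (div_nonneg hB hpos) (X_sub_C_mul_mem_intervalCone hp))
    (C_mul_mem_intervalCone (div_nonneg hA hpos) (C_sub_X_mul_mem_intervalCone hp))

/-- Complete the square: q = a(x + b/2a)² + e. If e/a ≤ 0 there would be a real root, so a and e
have the same sign, which is positive because q is positive somewhere. -/
theorem quadratic_mul_mem_intervalCone {n : ℕ} {p q : ℝ[X]} (hq : q.natDegree = 2)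
    (hroot : ∀ x, q.eval x ≠ 0) {x₀ : ℝ} (hx₀ : 0 < q.eval x₀) (hp : p ∈ intervalCone A B n) :
    q * p ∈ intervalCone A B (n + 2) := by
  obtain ⟨a, b, c, rfl⟩ : ∃ a b c, q = C a * X ^ 2 + C b * X + C c :=
    ⟨_, _, _, eq_quadratic_of_degree_le_two (natDegree_le_iff_degree_le.1 hq.le)⟩
  have ha : a ≠ 0 := by
    rintro rfl
    have : (C 0 * X ^ 2 + C b * X + C c : ℝ[X]).natDegree ≤ 1 := by
      simp only [C_0, zero_mul, zero_add]; exact natDegree_linear_le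
    omega
  set e : ℝ := c - b ^ 2 / (4 * a) with he
  have hev : ∀ x, (C a * X ^ 2 + C b * X + C c : ℝ[X]).eval x = a * (x + b / (2 * a)) ^ 2 + e := by
    intro x
    simp only [eval_add, eval_mul, eval_C, eval_X, eval_pow, he]
    field_simp
    ring
  have hlt : 0 < e / a := by
    by_contra hcon
    apply hroot (-(b / (2 * a)) + √(-(e / a)))
    rw [hev, neg_add_eq_sub, sub_add_cancel, Real.sq_sqrt (by linarith)]
    field_simp
    ring
  rw [hev] at hx₀
  have hapos : 0 < a := by
    rcases lt_or_gt_of_ne ha with h | h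
    · have : e < 0 := by
        by_contra h0
        have := div_nonpos_of_nonneg_of_nonpos (not_lt.1 h0) h.le
        linarith
      nlinarith [sq_nonneg (x₀ + b / (2 * a))]
    · exact h
  have hepos : 0 ≤ e := by
    have := mul_pos hlt hapos
    rw [div_mul_cancel₀ _ ha] at this
    exact this.le
  have key : (C a * X ^ 2 + C b * X + C c) * p =
      C a * ((X + C (b / (2 * a))) ^ 2 * p) + C e * p := by
    have h1 : (C a * X ^ 2 + C b * X + C c : ℝ[X]) = C a * (X + C (b / (2 * a))) ^ 2 + C e :=
      funext fun x => by rw [hev]; simp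
    rw [h1]; ring
  rw [key]
  exact add_mem (C_mul_mem_intervalCone hapos.le
      (sq_mul_mem_intervalCone (d := 1) (natDegree_X_add_C _).le hp))
    (C_mul_mem_intervalCone hepos (intervalCone_mono (by omega) hp))

/-- A polynomial without zeros on an interval keeps its sign there. -/
theorem eval_pos_of_ne_zero {q : ℝ[X]} (hq : ∀ x ∈ Set.Icc A B, q.eval x ≠ 0)
    (hA : 0 < q.eval A) : ∀ x ∈ Set.Icc A B, 0 < q.eval x := by
  intro x hx
  by_contra hcon
  obtain ⟨y, hy, hy0⟩ := intermediate_value_Icc' hx.1 q.continuous.continuousOn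
    (⟨not_lt.1 hcon, hA.le⟩ : (0 : ℝ) ∈ Set.Icc (q.eval x) (q.eval A))
  exact hq y ⟨hy.1, hy.2.trans hx.2⟩ hy0

/-- **Lukács' theorem**, for polynomials that are strictly positive on `[A, B]`. -/
theorem mem_intervalCone_of_pos (hAB : A < B) (n : ℕ) : ∀ p : ℝ[X], p.natDegree ≤ n →
    (∀ x ∈ Set.Icc A B, 0 < p.eval x) → p ∈ intervalCone A B n := by
  induction n using Nat.strong_induction_on with
  | _ n ih =>
  intro p hdeg hpos
  have hmA : A ∈ Set.Icc A B := Set.left_mem_Icc.2 hAB.le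
  have hmB : B ∈ Set.Icc A B := Set.right_mem_Icc.2 hAB.le
  by_cases h0 : p.natDegree = 0
  · rw [eq_C_of_natDegree_eq_zero h0] at hpos ⊢
    exact C_mem_intervalCone (by simpa using (hpos A hmA).le)
  have hu : ¬ IsUnit p := fun h => h0 (natDegree_eq_zero_of_isUnit h)
  have hp0 : p ≠ 0 := by rintro rfl; simp at h0
  -- Split off a real irreducible factor, of degree 1 or 2. Strict positivity of p keeps its roots
  -- off [A, B], so after a sign change both the factor and the cofactor are positive there, and the
  -- induction applies to the cofactor.
  obtain ⟨g, hg, hgp⟩ := WfDvdMonoid.exists_irreducible_factor hu hp0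
  have hgroot : ∀ x ∈ Set.Icc A B, g.eval x ≠ 0 := fun x hx h =>
    (hpos x hx).ne' (eval_eq_zero_of_dvd_of_eval_eq_zero hgp h)
  obtain ⟨q, hq, hqp, hqA⟩ : ∃ q : ℝ[X], Irreducible q ∧ q ∣ p ∧ 0 < q.eval A := by
    rcases lt_or_gt_of_ne (hgroot A hmA) with h | h
    · exact ⟨-g, (Associated.refl g).neg_left.irreducible_iff.2 hg, neg_dvd.2 hgp, by simpa using h⟩
    · exact ⟨g, hg, hgp, h⟩
  obtain ⟨r, rfl⟩ := hqp
  have hqpos := eval_pos_of_ne_zero (fun x hx h => (hpos x hx).ne' (by simp [h])) hqA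
  have hrpos : ∀ x ∈ Set.Icc A B, 0 < r.eval x := fun x hx => by
    have := hpos x hx
    rw [eval_mul] at this
    exact (pos_iff_pos_of_mul_pos this).1 (hqpos x hx)
  have hdegq : q.natDegree ≤ 2 := natDegree_le_of_degree_le hq.degree_le_two
  have hdegq0 : 0 < q.natDegree := natDegree_pos_iff_degree_pos.2 (degree_pos_of_irreducible hq)
  rw [natDegree_mul (left_ne_zero_of_mul hp0) (right_ne_zero_of_mul hp0)] at hdeg
  have hr := ih (n - q.natDegree) (by omega) r (by omega) hrpos
  obtain h1 | h2 : q.natDegree = 1 ∨ q.natDegree = 2 := by omega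
  · have := linear_mul_mem_intervalCone hAB h1.le hqA.le (hqpos B hmB).le hr
    exact intervalCone_mono (by omega) this
  · have hroot : ∀ x, q.eval x ≠ 0 := fun x hx => by
      have : q.natDegree = 1 :=
        natDegree_eq_of_degree_eq_some (degree_eq_one_of_irreducible_of_root hq hx)
      omega
    have := quadratic_mul_mem_intervalCone h2 hroot hqA hr
    exact intervalCone_mono (by omega) this

end Cone

/-! ### Sesquilinear forms of real matrices -/

section Sesq

open Matrix ComplexConjugate

theorem isSymm_vecMulVec_self {m : Type*} (a : m → ℝ) : (vecMulVec a a).IsSymm := by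
  ext i j
  simp [vecMulVec_apply, mul_comm]

theorem isSymm_vecMulVec_add {m : Type*} (a b : m → ℝ) : (vecMulVec a b + vecMulVec b a).IsSymm := by
  ext i j
  simp only [vecMulVec_apply, Matrix.transpose_apply, Matrix.add_apply]
  ring

variable {m n : Type*} [Fintype m] [Fintype n]

/-- The sesquilinear form `xᴴ M y` of a real matrix on complex vectors. -/
def sesq (M : Matrix m n ℝ) (x : m → ℂ) (y : n → ℂ) : ℂ :=
  star x ⬝ᵥ (cplx M *ᵥ y)

/-- The bilinear pairing of a real vector with a complex one. -/
def realDot (a : m → ℝ) (x : m → ℂ) : ℂ := ∑ i, (a i : ℂ) * x i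

theorem sesq_eq_sum (M : Matrix m n ℝ) (x : m → ℂ) (y : n → ℂ) :
    sesq M x y = ∑ i, ∑ j, (M i j : ℂ) * (conj (x i) * y j) := by
  simp only [sesq, dotProduct, mulVec, cplx, Matrix.map_apply, Pi.star_apply, Finset.mul_sum]
  refine Finset.sum_congr rfl fun i _ => Finset.sum_congr rfl fun j _ => ?_
  simp only [RCLike.star_def]
  ring

theorem sesq_add (M M' : Matrix m n ℝ) (x : m → ℂ) (y : n → ℂ) :
    sesq (M + M') x y = sesq M x y + sesq M' x y := by
  simp only [sesq_eq_sum, Matrix.add_apply, Complex.ofReal_add, add_mul, Finset.sum_add_distrib]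

theorem sesq_sub (M M' : Matrix m n ℝ) (x : m → ℂ) (y : n → ℂ) :
    sesq (M - M') x y = sesq M x y - sesq M' x y := by
  simp only [sesq_eq_sum, Matrix.sub_apply, Complex.ofReal_sub, sub_mul, Finset.sum_sub_distrib]

theorem sesq_smul (c : ℝ) (M : Matrix m n ℝ) (x : m → ℂ) (y : n → ℂ) :
    sesq (c • M) x y = c * sesq M x y := by
  simp only [sesq_eq_sum, Matrix.smul_apply, smul_eq_mul, Complex.ofReal_mul, mul_assoc,
    Finset.mul_sum]

theorem sesq_zero (x : m → ℂ) (y : n → ℂ) : sesq (0 : Matrix m n ℝ) x y = 0 := by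
  simp [sesq_eq_sum]

theorem sesq_transpose (M : Matrix m n ℝ) (x : m → ℂ) (y : n → ℂ) :
    sesq Mᵀ y x = conj (sesq M x y) := by
  simp only [sesq_eq_sum, map_sum, map_mul, Complex.conj_ofReal, Complex.conj_conj]
  rw [Finset.sum_comm]
  refine Finset.sum_congr rfl fun i _ => Finset.sum_congr rfl fun j _ => ?_
  simp only [Matrix.transpose_apply]
  ring

theorem sesq_vecMulVec (a : m → ℝ) (b : n → ℝ) (x : m → ℂ) (y : n → ℂ) :
    sesq (vecMulVec a b) x y = conj (realDot a x) * realDot b y := by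
  simp only [sesq_eq_sum, realDot, map_sum, map_mul, Complex.conj_ofReal, Finset.sum_mul_sum,
    vecMulVec_apply, Complex.ofReal_mul]
  refine Finset.sum_congr rfl fun i _ => Finset.sum_congr rfl fun j _ => ?_
  ring

theorem sesq_one [DecidableEq m] (x y : m → ℂ) :
    sesq (1 : Matrix m m ℝ) x y = ∑ i, conj (x i) * y i := by
  simp only [sesq_eq_sum, Matrix.one_apply, apply_ite Complex.ofReal, Complex.ofReal_one,
    Complex.ofReal_zero, ite_mul, one_mul, zero_mul, Finset.sum_ite_eq, Finset.mem_univ, if_true]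

theorem realDot_add (a b : m → ℝ) (x : m → ℂ) :
    realDot (a + b) x = realDot a x + realDot b x := by
  simp [realDot, add_mul, Finset.sum_add_distrib]

theorem realDot_sub (a b : m → ℝ) (x : m → ℂ) :
    realDot (a - b) x = realDot a x - realDot b x := by
  simp [realDot, sub_mul, Finset.sum_sub_distrib]

theorem posSemidef_vecMulVec_self (a : m → ℝ) : (vecMulVec a a).PosSemidef := by
  simpa using posSemidef_vecMulVec_self_star a

end Sesq

/-! ### Coefficient vectors and points of the unit circle -/

section Coefficients

open Polynomial ComplexConjugate

/-- The first `n` coefficients of a polynomial. -/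
def coeffVec (n : ℕ) (h : ℝ[X]) : Fin n → ℝ := fun i => h.coeff i

/-- The vector `(1, z, …, z^N)` at `z = e^{jω}`. -/
def circleVec (N : ℕ) (ω : ℝ) : Fin (N + 1) → ℂ := fun i => Complex.exp (Complex.I * ω) ^ (i : ℕ)

variable {N : ℕ}

theorem realDot_coeffVec_castSucc {h : ℝ[X]} (hh : h.natDegree < N) (w : Fin (N + 1) → ℂ) :
    realDot (coeffVec N h) (w ∘ Fin.castSucc) = realDot (coeffVec (N + 1) h) w := by
  simp [realDot, coeffVec, Fin.sum_univ_castSucc, coeff_eq_zero_of_natDegree_lt hh]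

/-- Passing from w to w₊ amounts to multiplying the polynomial by X, just as passing to w₋ changes
nothing for degree below N. Rank-one forms in w₋ and w₊ thus become forms in the same vector w. -/
theorem realDot_coeffVec_succ (h : ℝ[X]) (w : Fin (N + 1) → ℂ) :
    realDot (coeffVec N h) (w ∘ Fin.succ) = realDot (coeffVec (N + 1) (X * h)) w := by
  simp [realDot, coeffVec, Fin.sum_univ_succ, coeff_X_mul]

theorem realDot_coeffVec_circleVec {h : ℝ[X]} (hh : h.natDegree ≤ N) (ω : ℝ) :
    realDot (coeffVec (N + 1) h) (circleVec N ω) = aeval (Complex.exp (Complex.I * ω)) h := by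
  rw [aeval_eq_sum_range' (Nat.lt_succ_of_le hh), Finset.sum_range]
  simp [realDot, coeffVec, circleVec]

theorem conj_exp_I_mul (ω : ℝ) :
    conj (Complex.exp (Complex.I * ω)) = Complex.exp (-(Complex.I * ω)) := by
  rw [← Complex.exp_conj]; simp

theorem exp_I_mul_add_conj (ω : ℝ) :
    Complex.exp (Complex.I * ω) + conj (Complex.exp (Complex.I * ω)) = 2 * (Real.cos ω : ℝ) := by
  rw [conj_exp_I_mul, Complex.ofReal_cos, Complex.two_cos]
  ring_nf

theorem exp_I_mul_mul_conj (ω : ℝ) :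
    Complex.exp (Complex.I * ω) * conj (Complex.exp (Complex.I * ω)) = 1 := by
  rw [conj_exp_I_mul, ← Complex.exp_add, add_neg_cancel, Complex.exp_zero]

/-- A polynomial of degree `d` in `cos ω` is, up to the factor `z^d`, a polynomial of degree `2d`
in `z = e^{jω}`. -/
theorem exists_aeval_exp_eq (f : ℝ[X]) : ∃ h : ℝ[X], h.natDegree ≤ 2 * f.natDegree ∧
    ∀ ω : ℝ, aeval (Complex.exp (Complex.I * ω)) h =
      Complex.exp (Complex.I * ω) ^ f.natDegree * (f.eval (Real.cos ω) : ℝ) := by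
  set d := f.natDegree with hd
  -- This is z^d f((z + z⁻¹)/2) expanded term by term.
  refine ⟨∑ k ∈ Finset.range (d + 1), C (f.coeff k * (1 / 2) ^ k) * (X ^ (d - k) * (X ^ 2 + 1) ^ k),
    ?_, fun ω => ?_⟩
  · refine natDegree_sum_le_of_forall_le _ _ fun k hk => ?_
    have hk' : k ≤ d := Nat.lt_succ_iff.1 (Finset.mem_range.1 hk)
    refine (natDegree_C_mul_le _ _).trans (natDegree_mul_le.trans ?_)
    have h1 : (X ^ (d - k) : ℝ[X]).natDegree ≤ d - k := natDegree_X_pow_le _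
    have h2 : ((X ^ 2 + 1) ^ k : ℝ[X]).natDegree ≤ k * 2 :=
      natDegree_pow_le_of_le k (natDegree_add_le_of_degree_le (natDegree_X_pow_le _) (by simp))
    omega
  · set z := Complex.exp (Complex.I * ω) with hz
    rw [eval_eq_sum_range, Complex.ofReal_sum, Finset.mul_sum, map_sum, ← hd]
    refine Finset.sum_congr rfl fun k hk => ?_
    have hk' : k ≤ d := Nat.lt_succ_iff.1 (Finset.mem_range.1 hk)
    have h1 : z ^ 2 + 1 = z * (2 * (Real.cos ω : ℝ)) := by
      rw [← exp_I_mul_add_conj, ← hz, mul_add, exp_I_mul_mul_conj]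
      ring
    have h2 : z ^ d = z ^ (d - k) * z ^ k := by rw [← pow_add, Nat.sub_add_cancel hk']
    have h3 : ((1 / 2 : ℂ)) ^ k * 2 ^ k = 1 := by rw [← mul_pow]; norm_num
    simp only [map_mul, map_pow, map_add, map_one, aeval_X, aeval_C, h1, h2, mul_pow]
    simp only [Complex.coe_algebraMap, Complex.ofReal_mul, Complex.ofReal_pow]
    push_cast
    linear_combination (f.coeff k : ℂ) * z ^ (d - k) * z ^ k * Complex.cos ω ^ k * h3

end Coefficients

/-! ### Certificates of positivity on the frequency band -/

section Certificates

open Polynomial Matrix ComplexConjugate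

variable {N : ℕ} {ω₀ Ω : ℝ}

/-- The value at `w` of the Hermitian form
`e^{-jω₀} w₋ᴴ Y w₊ + e^{jω₀} w₊ᴴ Y w₋ - 2 cos Ω w₋ᴴ Y w₋`, where `w₋` omits the last entry of `w`
and `w₊` the first one. -/
def bandForm (ω₀ Ω : ℝ) (Y : Matrix (Fin N) (Fin N) ℝ) (w : Fin (N + 1) → ℂ) : ℝ :=
  2 * (Complex.exp (-(Complex.I * ω₀)) * sesq Y (w ∘ Fin.castSucc) (w ∘ Fin.succ)).re
    - 2 * Real.cos Ω * (sesq Y (w ∘ Fin.castSucc) (w ∘ Fin.castSucc)).re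

theorem bandForm_add (Y Y' : Matrix (Fin N) (Fin N) ℝ) (w : Fin (N + 1) → ℂ) :
    bandForm ω₀ Ω (Y + Y') w = bandForm ω₀ Ω Y w + bandForm ω₀ Ω Y' w := by
  simp only [bandForm, sesq_add, mul_add, Complex.add_re]
  ring

theorem bandForm_smul (c : ℝ) (Y : Matrix (Fin N) (Fin N) ℝ) (w : Fin (N + 1) → ℂ) :
    bandForm ω₀ Ω (c • Y) w = c * bandForm ω₀ Ω Y w := by
  simp only [bandForm, sesq_smul, mul_left_comm _ (c : ℂ), Complex.re_ofReal_mul]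
  ring

/-- A pair of real matrices certifying that `p (cos ω)` is nonnegative on the band
`[ω₀ - Ω, ω₀ + Ω]`. -/
def BandCert (N : ℕ) (ω₀ Ω : ℝ) (p : ℝ[X]) : Prop :=
  ∃ (Θ : Matrix (Fin (N + 1)) (Fin (N + 1)) ℝ) (Y : Matrix (Fin N) (Fin N) ℝ),
    Θ.IsSymm ∧ Y.PosSemidef ∧
    (∀ ω : ℝ, sesq Θ (circleVec N ω) (circleVec N ω) = (p.eval (Real.cos ω) : ℝ)) ∧
    ∀ w, bandForm ω₀ Ω Y w ≤ (sesq Θ w w).re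

theorem bandCert_zero : BandCert N ω₀ Ω 0 :=
  ⟨0, 0, by simp [Matrix.IsSymm], .zero, by simp [sesq_zero], by simp [bandForm, sesq_zero]⟩

theorem BandCert.add {p q : ℝ[X]} (hp : BandCert N ω₀ Ω p) (hq : BandCert N ω₀ Ω q) :
    BandCert N ω₀ Ω (p + q) := by
  obtain ⟨Θ, Y, h1, h2, h3, h4⟩ := hp
  obtain ⟨Θ', Y', h1', h2', h3', h4'⟩ := hq
  refine ⟨Θ + Θ', Y + Y', h1.add h1', h2.add h2', fun ω => ?_, fun w => ?_⟩
  · rw [sesq_add, h3, h3', eval_add, Complex.ofReal_add]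
  · rw [sesq_add, bandForm_add, Complex.add_re]
    exact add_le_add (h4 w) (h4' w)

/-- The explicit certificates below are free of denominators only after scaling by 2 sin Ω or 4;
this removes the factor. -/
theorem BandCert.of_C_mul {p : ℝ[X]} {c : ℝ} (hc : 0 < c) (hp : BandCert N ω₀ Ω (C c * p)) :
    BandCert N ω₀ Ω p := by
  obtain ⟨Θ, Y, h1, h2, h3, h4⟩ := hp
  refine ⟨c⁻¹ • Θ, c⁻¹ • Y, h1.smul _, h2.smul (inv_nonneg.2 hc.le), fun ω => ?_, fun w => ?_⟩
  · rw [sesq_smul, h3, eval_mul, eval_C, ← Complex.ofReal_mul, inv_mul_cancel_left₀ hc.ne']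
  · rw [sesq_smul, bandForm_smul, Complex.re_ofReal_mul]
    exact mul_le_mul_of_nonneg_left (h4 w) (inv_nonneg.2 hc.le)

theorem conj_mul_circle (d : ℕ) (ω r : ℝ) :
    conj (Complex.exp (Complex.I * ω) ^ d * (r : ℂ)) * (Complex.exp (Complex.I * ω) ^ d * (r : ℂ)) =
      r ^ 2 := by
  have := exp_I_mul_mul_conj ω
  rw [map_mul, map_pow, Complex.conj_ofReal]
  calc _ = (Complex.exp (Complex.I * ω) * conj (Complex.exp (Complex.I * ω))) ^ d * r ^ 2 := by ring
    _ = _ := by rw [this]; simp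

theorem bandCert_sq {f : ℝ[X]} (hf : 2 * f.natDegree ≤ N) : BandCert N ω₀ Ω (f ^ 2) := by
  obtain ⟨h, hdeg, hh⟩ := exists_aeval_exp_eq f
  refine ⟨vecMulVec (coeffVec (N + 1) h) (coeffVec (N + 1) h), 0, isSymm_vecMulVec_self _, .zero,
    fun ω => ?_, fun w => ?_⟩
  · rw [sesq_vecMulVec, realDot_coeffVec_circleVec (hdeg.trans hf), hh, conj_mul_circle, eval_pow,
      Complex.ofReal_pow]
  · rw [sesq_vecMulVec, ← Complex.normSq_eq_conj_mul_self]
    simpa [bandForm, sesq_zero] using Complex.normSq_nonneg _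

theorem exp_neg_I_mul_re_im (ω : ℝ) : (Complex.exp (-(Complex.I * ω))).re = Real.cos ω ∧
    (Complex.exp (-(Complex.I * ω))).im = -Real.sin ω := by
  rw [← conj_exp_I_mul, mul_comm]
  simp [Complex.exp_ofReal_mul_I_re, Complex.exp_ofReal_mul_I_im]

/-- The certificates for the end points of the band; `β` is one of `ω₀ ± Ω` and `s = ± sin Ω`. -/
theorem bandCert_linear_mul_sq {β s : ℝ} (hω₀ : 0 ≤ Real.sin ω₀) (hβ : 0 ≤ Real.sin β)
    (hs : s = Real.sin (β - ω₀)) (hc : Real.cos Ω = Real.cos (β - ω₀)) {f : ℝ[X]}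
    (hf : 1 + 2 * f.natDegree ≤ N) :
    BandCert N ω₀ Ω (C (2 * s) * ((X - C (Real.cos β)) * f ^ 2)) := by
  obtain ⟨h, hdeg, hh⟩ := exists_aeval_exp_eq f
  set a := coeffVec (N + 1) h
  set b := coeffVec (N + 1) (X * h)
  have hXdeg : (X * h).natDegree ≤ N := by
    have := natDegree_mul_le (p := (X : ℝ[X])) (q := h)
    have := natDegree_X_le (R := ℝ)
    omega
  -- With x and y the pairings of w with h and Xh, the matrices are chosen so that Θ - `bandForm`
  -- equals sin ω₀ · |y - e^{jβ}x|². This works because sin(β - ω₀) - sin β e^{-jω₀} = -sin ω₀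
  -- e^{-jβ}.
  refine ⟨Real.sin ω₀ • vecMulVec b b + (Real.sin ω₀ - 2 * Real.cos Ω * Real.sin β) • vecMulVec a a
      + s • (vecMulVec a b + vecMulVec b a),
    Real.sin β • vecMulVec (coeffVec N h) (coeffVec N h), ?_, ?_, fun ω => ?_, fun w => ?_⟩
  · exact (((isSymm_vecMulVec_self b).smul _).add ((isSymm_vecMulVec_self a).smul _)).add
      ((isSymm_vecMulVec_add a b).smul _)
  · exact (posSemidef_vecMulVec_self _).smul hβ
  · have ha : realDot a (circleVec N ω) = _ :=
      (realDot_coeffVec_circleVec (by omega) ω).trans (hh ω)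
    have hb : realDot b (circleVec N ω) = _ := realDot_coeffVec_circleVec hXdeg ω
    rw [map_mul, aeval_X, hh ω] at hb
    simp only [sesq_add, sesq_smul, sesq_vecMulVec, ha, hb]
    have h1 := conj_mul_circle f.natDegree ω (f.eval (Real.cos ω))
    obtain ⟨g, hg⟩ : ∃ g, Complex.exp (Complex.I * ω) ^ f.natDegree *
      ((f.eval (Real.cos ω) : ℝ) : ℂ) = g := ⟨_, rfl⟩
    simp only [hg] at h1 ⊢
    have h2 := exp_I_mul_mul_conj ω
    have h3 := exp_I_mul_add_conj ω
    set z := Complex.exp (Complex.I * ω)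
    have h4 : ((Real.sin ω₀ : ℝ) : ℂ) - Real.cos Ω * Real.sin β = -(s * Real.cos β) := by
      rw [hs, hc]
      norm_cast
      have : Real.sin ω₀ = Real.sin β * Real.cos (β - ω₀) - Real.cos β * Real.sin (β - ω₀) := by
        rw [← Real.sin_sub]; ring_nf
      rw [this]; ring
    simp only [eval_mul, eval_sub, eval_C, eval_X, eval_pow]
    push_cast [map_mul] at h1 h2 h3 h4 ⊢
    linear_combination conj g * g * Complex.sin ω₀ * h2 + conj g * g * s * h3 +
      2 * conj g * g * h4 + (2 * s * (Complex.cos ω - Complex.cos β)) * h1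
  · obtain ⟨he1, he2⟩ := exp_neg_I_mul_re_im ω₀
    simp only [bandForm, sesq_add, sesq_smul, sesq_vecMulVec,
      realDot_coeffVec_castSucc (show h.natDegree < N by omega), realDot_coeffVec_succ]
    change 2 * (_ * (_ * (conj (realDot a w) * realDot b w))).re -
      2 * _ * (_ * (conj (realDot a w) * realDot a w)).re ≤ _
    set x := realDot a w
    set y := realDot b w
    have hs' := hs
    rw [Real.sin_sub] at hs'
    have key : 0 ≤ Real.sin ω₀ * ((y.re - Real.cos β * x.re + Real.sin β * x.im) ^ 2 +
        (y.im - Real.cos β * x.im - Real.sin β * x.re) ^ 2) := by positivity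
    simp only [Complex.add_re, Complex.mul_re, Complex.mul_im, Complex.conj_re, Complex.conj_im,
      Complex.ofReal_re, Complex.ofReal_im, he1, he2, Complex.add_im]
    rw [hs']
    have h1 := Real.sin_sq_add_cos_sq β
    linarith [congrArg (fun t => Real.sin ω₀ * (x.re ^ 2 + x.im ^ 2) * t) h1, key]

/-- The certificate for the interior of the band. -/
theorem bandCert_quadratic_mul_sq (h1 : 0 ≤ Real.cos Ω - Real.cos ω₀)
    (h2 : 0 ≤ Real.cos Ω + Real.cos ω₀) {f : ℝ[X]} (hf : 2 + 2 * f.natDegree ≤ N) :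
    BandCert N ω₀ Ω
      (C 4 * ((X - C (Real.cos (ω₀ + Ω))) * (C (Real.cos (ω₀ - Ω)) - X) * f ^ 2)) := by
  obtain ⟨h, hdeg, hh⟩ := exists_aeval_exp_eq f
  have hX1 : (X * h).natDegree ≤ 1 + h.natDegree :=
    natDegree_mul_le.trans (add_le_add_left natDegree_X_le _)
  have hX2 : (X * (X * h)).natDegree ≤ 1 + (X * h).natDegree :=
    natDegree_mul_le.trans (add_le_add_left natDegree_X_le _)
  set a := coeffVec (N + 1) h
  set b := coeffVec (N + 1) (X * h)
  set c := coeffVec (N + 1) (X * (X * h))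
  set a' := coeffVec N h
  set b' := coeffVec N (X * h)
  -- With x, y, u the pairings of w with h, Xh, X²h, the matrices make Θ - `bandForm` equal to
  -- |e^{-jω₀}u + e^{jω₀}x - 2 cos Ω y|². The matrix Y is 2 cos Ω (aaᵀ + bbᵀ) - 2 cos ω₀ (abᵀ + baᵀ)
  -- for the truncated a, b, regrouped to show that it is semidefinite.
  refine ⟨vecMulVec c c + (1 - 4 * Real.cos Ω ^ 2) • vecMulVec a a
      + (-4 * Real.cos ω₀ ^ 2) • vecMulVec b b
      + (4 * Real.cos Ω * Real.cos ω₀) • (vecMulVec a b + vecMulVec b a)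
      - (vecMulVec a c + vecMulVec c a),
    (Real.cos Ω - Real.cos ω₀) • vecMulVec (a' + b') (a' + b') +
      (Real.cos Ω + Real.cos ω₀) • vecMulVec (a' - b') (a' - b'), ?_, ?_, fun ω => ?_, fun w => ?_⟩
  · exact ((((isSymm_vecMulVec_self c).add ((isSymm_vecMulVec_self a).smul _)).add
      ((isSymm_vecMulVec_self b).smul _)).add ((isSymm_vecMulVec_add a b).smul _)).sub
      (isSymm_vecMulVec_add a c)
  · exact ((posSemidef_vecMulVec_self _).smul h1).add ((posSemidef_vecMulVec_self _).smul h2)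
  · have ha : realDot a (circleVec N ω) = _ :=
      (realDot_coeffVec_circleVec (by omega) ω).trans (hh ω)
    have hb : realDot b (circleVec N ω) = _ := realDot_coeffVec_circleVec (by omega) ω
    have hc : realDot c (circleVec N ω) = _ := realDot_coeffVec_circleVec (by omega) ω
    rw [map_mul, aeval_X, hh ω] at hb
    rw [map_mul, map_mul, aeval_X, hh ω] at hc
    simp only [sesq_add, sesq_sub, sesq_smul, sesq_vecMulVec, ha, hb, hc]
    have e1 := conj_mul_circle f.natDegree ω (f.eval (Real.cos ω))
    obtain ⟨g, hg⟩ : ∃ g, Complex.exp (Complex.I * ω) ^ f.natDegree *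
      ((f.eval (Real.cos ω) : ℝ) : ℂ) = g := ⟨_, rfl⟩
    simp only [hg] at e1 ⊢
    have e2 := exp_I_mul_mul_conj ω
    have e3 := exp_I_mul_add_conj ω
    set z := Complex.exp (Complex.I * ω)
    have e4 := Complex.sin_sq_add_cos_sq (ω₀ : ℂ)
    have e5 := Complex.sin_sq_add_cos_sq (Ω : ℂ)
    simp only [eval_mul, eval_sub, eval_C, eval_X, eval_pow, Real.cos_add, Real.cos_sub]
    push_cast [map_mul] at e1 e2 e3 e4 e5 ⊢
    set F : ℂ := ((f.eval (Real.cos ω) : ℝ) : ℂ)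
    linear_combination
      conj g * g * (z * conj z + 3 - 4 * Complex.cos ω₀ ^ 2) * e2
      + conj g * g * (4 * Complex.cos Ω * Complex.cos ω₀ - (z + conj z + 2 * Complex.cos ω)) * e3
      + 4 * (1 - Complex.cos Ω ^ 2 - Complex.cos ω₀ ^ 2
          + 2 * Complex.cos Ω * Complex.cos ω₀ * Complex.cos ω - Complex.cos ω ^ 2) * e1
      - 4 * F ^ 2 * Complex.sin ω₀ ^ 2 * e5 - 4 * F ^ 2 * (1 - Complex.cos Ω ^ 2) * e4
  · obtain ⟨he1, he2⟩ := exp_neg_I_mul_re_im ω₀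
    have ha1 : realDot a' (w ∘ Fin.castSucc) = realDot a w := realDot_coeffVec_castSucc (by omega) w
    have hb1 : realDot b' (w ∘ Fin.castSucc) = realDot b w := realDot_coeffVec_castSucc (by omega) w
    have ha2 : realDot a' (w ∘ Fin.succ) = realDot b w := realDot_coeffVec_succ _ w
    have hb2 : realDot b' (w ∘ Fin.succ) = realDot c w := realDot_coeffVec_succ _ w
    simp only [bandForm, sesq_add, sesq_sub, sesq_smul, sesq_vecMulVec, realDot_add, realDot_sub,
      ha1, hb1, ha2, hb2]
    set x := realDot a w
    set y := realDot b w
    set u := realDot c w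
    have e4 := Real.sin_sq_add_cos_sq ω₀
    have key : 0 ≤ (Real.cos ω₀ * (u.re + x.re) + Real.sin ω₀ * (u.im - x.im)
          - 2 * Real.cos Ω * y.re) ^ 2
        + (Real.cos ω₀ * (u.im + x.im) - Real.sin ω₀ * (u.re - x.re)
          - 2 * Real.cos Ω * y.im) ^ 2 := by positivity
    simp only [Complex.add_re, Complex.mul_re, Complex.mul_im, Complex.conj_re, Complex.conj_im,
      Complex.ofReal_re, Complex.ofReal_im, he1, he2, Complex.add_im, Complex.sub_re,
      Complex.sub_im, map_add, map_sub]
    linarith [congrArg (fun t => (x.re ^ 2 + x.im ^ 2 + u.re ^ 2 + u.im ^ 2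
      - 2 * (x.re * u.re + x.im * u.im)) * t) e4, key]

/-- The cone of sums of `(X - A)^i (B - X)^j f²`, where `A` and `B` are the cosines of the end
points of the band, consists of polynomials with a certificate. -/
theorem bandCert_of_mem_intervalCone (hω₀ : ω₀ ∈ Set.Ioo 0 Real.pi) (hΩ : 0 < Ω)
    (hl : Ω ≤ ω₀) (hr : ω₀ + Ω ≤ Real.pi) {p : ℝ[X]}
    (hp : p ∈ intervalCone (Real.cos (ω₀ + Ω)) (Real.cos (ω₀ - Ω)) N) : BandCert N ω₀ Ω p := by
  have hsω : 0 ≤ Real.sin ω₀ := (Real.sin_pos_of_mem_Ioo hω₀).le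
  have hsΩ : 0 < Real.sin Ω := Real.sin_pos_of_pos_of_lt_pi hΩ (by linarith [hω₀.2])
  induction hp using AddSubmonoid.closure_induction with
  | zero => exact bandCert_zero
  | add x y _ _ hx hy => exact hx.add hy
  | mem p hp =>
    obtain ⟨i, j, f, hd, rfl⟩ := hp
    set A := Real.cos (ω₀ + Ω) with hA
    set B := Real.cos (ω₀ - Ω) with hB
    -- Even powers of the end point factors go into the square, leaving exponents 0 or 1 and hence
    -- four cases.
    set q : ℝ[X] := (X - C A) ^ (i / 2) * (C B - X) ^ (j / 2) * f
    have hq : q.natDegree ≤ i / 2 + j / 2 + f.natDegree := by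
      refine natDegree_mul_le.trans (add_le_add_left (natDegree_mul_le.trans (add_le_add ?_ ?_)) _)
      · exact (natDegree_pow_le_of_le _ (natDegree_X_sub_C_le A)).trans (by simp)
      · refine (natDegree_pow_le_of_le (m := 1) _ ?_).trans (by simp)
        exact (natDegree_sub_le _ _).trans (by simp)
    have hsplit : (X - C A) ^ i * (C B - X) ^ j * f ^ 2 =
        (X - C A) ^ (i % 2) * (C B - X) ^ (j % 2) * q ^ 2 := by
      conv_lhs => rw [← Nat.mod_add_div i 2, ← Nat.mod_add_div j 2]
      ring
    rw [hsplit]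
    rcases Nat.mod_two_eq_zero_or_one i with hi | hi <;>
      rcases Nat.mod_two_eq_zero_or_one j with hj | hj <;> rw [hi, hj]
    · simpa using bandCert_sq (by omega)
    -- At the end point ω₀ - Ω the sign s = -sin Ω turns X - B into B - X.
    · have := bandCert_linear_mul_sq (N := N) (Ω := Ω) (β := ω₀ - Ω) (s := -Real.sin Ω) (f := q) hsω
        (Real.sin_nonneg_of_nonneg_of_le_pi (by linarith) (by linarith)) (by simp) (by simp)
        (by omega)
      refine BandCert.of_C_mul (c := 2 * Real.sin Ω) (by positivity) ?_
      convert this using 1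
      simp only [pow_zero, pow_one, C_mul, C_neg]
      ring
    · have := bandCert_linear_mul_sq (N := N) (Ω := Ω) (β := ω₀ + Ω) (s := Real.sin Ω) (f := q) hsω
        (Real.sin_nonneg_of_nonneg_of_le_pi (by linarith) (by linarith)) (by simp) (by simp)
        (by omega)
      refine BandCert.of_C_mul (c := 2 * Real.sin Ω) (by positivity) ?_
      simpa using this
    -- Since Ω ≤ ω₀ and Ω ≤ π - ω₀, cos Ω ≥ |cos ω₀|, as semidefiniteness of Y requires.
    · have h1 : Real.cos ω₀ ≤ Real.cos Ω :=
        Real.cos_le_cos_of_nonneg_of_le_pi hΩ.le hω₀.2.le hl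
      have h2 : Real.cos (Real.pi - ω₀) ≤ Real.cos Ω :=
        Real.cos_le_cos_of_nonneg_of_le_pi hΩ.le (by linarith [hω₀.1]) (by linarith)
      rw [Real.cos_pi_sub] at h2
      have := bandCert_quadratic_mul_sq (N := N) (Ω := Ω) (ω₀ := ω₀) (f := q) (by linarith)
        (by linarith) (by omega)
      refine BandCert.of_C_mul (c := 4) (by norm_num) ?_
      simpa using this

end Certificates

/-! ### Symbols of real symmetric matrices -/

section Symbol

open Polynomial Matrix ComplexConjugate

variable {N : ℕ}

theorem sesq_circleVec (K : Matrix (Fin (N + 1)) (Fin (N + 1)) ℝ) (ω : ℝ) :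
    sesq K (circleVec N ω) (circleVec N ω) =
      ∑ i, ∑ j, (K i j : ℂ) * Complex.exp ((((j : ℕ) : ℤ) - ((i : ℕ) : ℤ) : ℤ) * ω * Complex.I) := by
  rw [sesq_eq_sum]
  refine Finset.sum_congr rfl fun i _ => Finset.sum_congr rfl fun j _ => ?_
  simp only [circleVec, map_pow, conj_exp_I_mul]
  rw [← Complex.exp_nat_mul, ← Complex.exp_nat_mul, ← Complex.exp_add]
  push_cast
  ring_nf

/-- The symbol of a real symmetric matrix is a polynomial in `cos ω`. -/
theorem exists_symbol_polynomial {K : Matrix (Fin (N + 1)) (Fin (N + 1)) ℝ} (hK : K.IsSymm) :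
    ∃ p : ℝ[X], p.natDegree ≤ N ∧
      ∀ ω : ℝ, sesq K (circleVec N ω) (circleVec N ω) = (p.eval (Real.cos ω) : ℝ) := by
  -- Symmetry makes the symbol real, so each K_ij e^{j(j-i)ω} may be replaced by its real part K_ij
  -- cos((j - i)ω), a Chebyshev polynomial in cos ω.
  refine ⟨∑ i, ∑ j, C (K i j) * Chebyshev.T ℝ (((j : ℕ) : ℤ) - ((i : ℕ) : ℤ)), ?_, fun ω => ?_⟩
  · refine natDegree_sum_le_of_forall_le _ _ fun i _ =>
      natDegree_sum_le_of_forall_le _ _ fun j _ => (natDegree_C_mul_le _ _).trans ?_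
    rw [Chebyshev.natDegree_T]
    omega
  · have hre : sesq K (circleVec N ω) (circleVec N ω) =
        ((sesq K (circleVec N ω) (circleVec N ω)).re : ℂ) := by
      refine (Complex.conj_eq_iff_re.1 ?_).symm
      rw [← sesq_transpose, hK.eq]
    rw [hre, sesq_circleVec, eval_finsetSum]
    simp only [eval_finsetSum, Complex.re_sum, Complex.re_ofReal_mul, eval_mul, eval_C,
      Chebyshev.T_real_cos]
    congr 1
    refine Finset.sum_congr rfl fun i _ => Finset.sum_congr rfl fun j _ => ?_
    rw [← Complex.exp_ofReal_mul_I_re]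
    push_cast
    rfl

theorem infinite_range_exp_I_mul : (Set.range fun ω : ℝ => Complex.exp (Complex.I * ω)).Infinite := by
  have hinj : Set.InjOn (fun ω : ℝ => Complex.exp (Complex.I * ω)) (Set.Icc 0 Real.pi) := by
    intro x hx y hy hxy
    refine Real.injOn_cos hx hy ?_
    have := congrArg Complex.re hxy
    simpa only [mul_comm Complex.I, Complex.exp_ofReal_mul_I_re] using this
  exact ((Set.Icc_infinite Real.pi_pos).image hinj).mono (Set.image_subset_range _ _)

/-- If the symbol of a real matrix vanishes, then so do its sums along diagonals. -/
theorem diagonal_sum_eq_zero {K : Matrix (Fin (N + 1)) (Fin (N + 1)) ℝ}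
    (hK : ∀ ω : ℝ, sesq K (circleVec N ω) (circleVec N ω) = 0) (m : ℕ) :
    ∑ i : Fin (N + 1), ∑ j : Fin (N + 1), (if m + i = N + j then K i j else 0) = 0 := by
  -- The symbol times z^N has no negative powers. It vanishes on the infinite unit circle, so all
  -- coefficients are zero; that of z^m is the sum over the diagonal j - i = m - N.
  set Q : ℂ[X] := ∑ i : Fin (N + 1), ∑ j : Fin (N + 1), C (K i j : ℂ) * X ^ (N + j - i : ℕ) with hQ
  have hQ0 : Q = 0 := by
    refine eq_zero_of_infinite_isRoot _ (infinite_range_exp_I_mul.mono ?_)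
    rintro _ ⟨ω, rfl⟩
    have h := hK ω
    rw [sesq_eq_sum] at h
    simp only [Set.mem_ofPred_eq, IsRoot.def, hQ, eval_finsetSum, eval_mul, eval_C, eval_pow, eval_X]
    have h1 := exp_I_mul_mul_conj ω
    simp only [circleVec, map_pow] at h
    set z := Complex.exp (Complex.I * ω)
    rw [← mul_zero (z ^ N), ← h, Finset.mul_sum]
    refine Finset.sum_congr rfl fun i _ => ?_
    rw [Finset.mul_sum]
    refine Finset.sum_congr rfl fun j _ => ?_
    have h2 : z ^ N * z ^ (j : ℕ) = z ^ (N + j - i : ℕ) * z ^ (i : ℕ) := by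
      rw [← pow_add, ← pow_add]; congr 1; omega
    have h3 : z ^ (i : ℕ) * conj z ^ (i : ℕ) = 1 := by rw [← mul_pow, h1, one_pow]
    linear_combination -(K i j : ℂ) * conj z ^ (i : ℕ) * h2 - K i j * z ^ (N + j - i : ℕ) * h3
  have hc := congrArg (fun q => (q.coeff m).re) hQ0
  simp only [hQ, finsetSum_coeff, coeff_C_mul, coeff_X_pow, Complex.re_sum, coeff_zero,
    Complex.zero_re] at hc
  refine Eq.trans ?_ hc
  refine Finset.sum_congr rfl fun i _ => Finset.sum_congr rfl fun j _ => ?_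
  have : m = N + j - i ↔ m + i = N + j := by omega
  simp only [this]
  split_ifs <;> simp

/-- Partial sums along the diagonals of an infinite matrix. -/
def diagPartialSum (k : ℕ → ℕ → ℝ) : ℕ → ℕ → ℝ
  | 0, j => k 0 j
  | i + 1, 0 => k (i + 1) 0
  | i + 1, j + 1 => diagPartialSum k i j + k (i + 1) (j + 1)

theorem diagPartialSum_symm {k : ℕ → ℕ → ℝ} (hk : ∀ i j, k i j = k j i) (i : ℕ) :
    ∀ j, diagPartialSum k i j = diagPartialSum k j i := by
  induction i with
  | zero => rintro (_ | j) <;> simp [diagPartialSum, hk 0]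
  | succ i ih =>
    rintro (_ | j)
    · simp [diagPartialSum, hk 0]
    · simp [diagPartialSum, ih j, hk (i + 1)]

theorem diagPartialSum_add (k : ℕ → ℕ → ℝ) (i d : ℕ) :
    diagPartialSum k i (i + d) = ∑ l ∈ Finset.range (i + 1), k l (l + d) := by
  induction i with
  | zero => simp [diagPartialSum]
  | succ i ih =>
    rw [Finset.sum_range_succ, ← ih, Nat.add_right_comm i 1 d, diagPartialSum]

/-- A real symmetric matrix with vanishing symbol is a displacement `X₋ - X₊`. -/
theorem exists_displacement {K : Matrix (Fin (N + 1)) (Fin (N + 1)) ℝ} (hsymm : K.IsSymm)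
    (hK : ∀ ω : ℝ, sesq K (circleVec N ω) (circleVec N ω) = 0) :
    ∃ X : Matrix (Fin N) (Fin N) ℝ, X.IsSymm ∧ ∀ w : Fin (N + 1) → ℂ,
      sesq K w w = sesq X (w ∘ Fin.castSucc) (w ∘ Fin.castSucc)
        - sesq X (w ∘ Fin.succ) (w ∘ Fin.succ) := by
  set k : ℕ → ℕ → ℝ := fun i j =>
    if h : i < N + 1 ∧ j < N + 1 then K ⟨i, h.1⟩ ⟨j, h.2⟩ else 0 with hk
  have hkK : ∀ i j : Fin (N + 1), k i j = K i j := fun i j => dif_pos ⟨i.2, j.2⟩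
  have hks : ∀ i j, k i j = k j i := fun i j => by
    simp only [hk, and_comm (a := i < N + 1)]
    split_ifs with h
    · exact hsymm.apply _ _
    · rfl
  set x := diagPartialSum k
  have hxs : ∀ i j, x i j = x j i := diagPartialSum_symm hks
  -- An entry in the last column is a sum over an entire diagonal, hence zero. With symmetry, the
  -- last row and column of x vanish, so truncating x to size N loses nothing.
  have hlast : ∀ i : Fin (N + 1), x i N = 0 := by
    intro i
    obtain ⟨d, hd⟩ := Nat.exists_eq_add_of_le (Nat.lt_succ_iff.1 i.2)
    have h1 := diagPartialSum_add k i d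
    rw [← hd] at h1
    refine h1.trans ?_
    rw [← diagonal_sum_eq_zero hK (N + d), Finset.sum_fin_eq_sum_range]
    have hsub : Finset.range (i + 1) ⊆ Finset.range (N + 1) :=
      Finset.range_subset_range.2 (by omega)
    rw [← Finset.sum_subset hsub]
    · refine Finset.sum_congr rfl fun l hl => ?_
      have hl' := Finset.mem_range.1 hl
      have hlt : l < N + 1 := by omega
      rw [dif_pos hlt, Finset.sum_eq_single ⟨l + d, by omega⟩]
      · simp only [hk]
        rw [dif_pos ⟨hlt, by omega⟩, if_pos (by omega)]
      · intro j _ hj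
        rw [if_neg]
        intro h
        exact hj (Fin.ext (by simp only at h ⊢; omega))
      · simp
    · intro l _ hl
      have hl' := mt Finset.mem_range.2 hl
      split_ifs with hlt
      · refine Finset.sum_eq_zero fun j _ => if_neg ?_
        simp only
        omega
      · rfl
  refine ⟨Matrix.of fun i j => x i j, Matrix.IsSymm.ext fun i j => hxs _ _, fun w => ?_⟩
  have hlo : sesq (Matrix.of fun i j : Fin N => x i j) (w ∘ Fin.castSucc) (w ∘ Fin.castSucc) =
      sesq (Matrix.of fun i j : Fin (N + 1) => x i j) w w := by
    have h1 : ∀ i : Fin N, x i N = 0 := fun i => hlast i.castSucc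
    have h2 : ∀ i : Fin (N + 1), x N i = 0 := fun i => (hxs _ _).trans (hlast i)
    simp [sesq_eq_sum, Fin.sum_univ_castSucc (n := N), h1,
      show ∀ i : Fin N, x N i = 0 from fun i => h2 i.castSucc,
      show x N N = 0 from h2 (Fin.last N)]
  have h0 : ∀ j, x 0 j = k 0 j := fun j => by simp [x, diagPartialSum]
  have h0' : ∀ j, x j 0 = k j 0 := fun j => by rw [hxs, h0, hks]
  -- This recursion is the displacement identity itself: x minus its diagonal shift is k.
  have hs : ∀ i j, x (i + 1) (j + 1) = x i j + k (i + 1) (j + 1) := fun i j => rfl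
  rw [hlo, eq_sub_iff_add_eq]
  simp only [sesq_eq_sum, ← hkK, Matrix.of_apply, Function.comp]
  simp only [Fin.sum_univ_succ (n := N), Fin.val_zero, Fin.val_succ, h0, h0', hs,
    Complex.ofReal_add, add_mul, Finset.sum_add_distrib]
  ring

end Symbol

/-! ### The linear matrix inequality as a Hermitian form -/

section LMI

open Matrix ComplexConjugate

theorem cplx_mul {l m n : Type*} [Fintype m] (M : Matrix l m ℝ) (M' : Matrix m n ℝ) :
    cplx (M * M') = cplx M * cplx M' :=
  Matrix.map_mul (f := Complex.ofRealHom)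

theorem cplx_conjTranspose {m n : Type*} (M : Matrix m n ℝ) : (cplx M)ᴴ = cplx Mᵀ := by
  ext i j
  simp [cplx]

theorem cplx_transpose {m n : Type*} (M : Matrix m n ℝ) : (cplx M)ᵀ = cplx Mᵀ := rfl

variable {l m n : Type*} [Fintype l] [Fintype m] [Fintype n]

theorem sesq_mul_right (M : Matrix l m ℝ) (P : Matrix m n ℝ) (x : l → ℂ) (y : n → ℂ) :
    sesq (M * P) x y = sesq M x (cplx P *ᵥ y) := by
  rw [sesq, cplx_mul, ← mulVec_mulVec, sesq]

theorem sesq_transpose_left (P : Matrix m l ℝ) (M : Matrix m n ℝ) (x : l → ℂ) (y : n → ℂ) :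
    sesq Pᵀ x (cplx M *ᵥ y) = sesq M (cplx P *ᵥ x) y := by
  rw [sesq, sesq, star_mulVec, cplx_conjTranspose, dotProduct_mulVec]

theorem sesq_add_right (M : Matrix m n ℝ) (x : m → ℂ) (y y' : n → ℂ) :
    sesq M x (y + y') = sesq M x y + sesq M x y' := by
  rw [sesq, mulVec_add, dotProduct_add]; rfl

theorem sesq_add_left (M : Matrix m n ℝ) (x x' : m → ℂ) (y : n → ℂ) :
    sesq M (x + x') y = sesq M x y + sesq M x' y := by
  rw [sesq, star_add, add_dotProduct]; rfl

theorem sesq_self_eq_ofReal_re {M : Matrix m m ℝ} (hM : M.IsSymm) (x : m → ℂ) :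
    sesq M x x = ((sesq M x x).re : ℂ) := by
  refine (Complex.conj_eq_iff_re.1 ?_).symm
  rw [← sesq_transpose, hM.eq]

variable {N : ℕ}

/-- The coefficients of `z^N (1 + R(z))`, in ascending order. -/
def ntfVec (α : Fin (N + 1) → ℝ) : Fin (N + 1) → ℝ :=
  (fun i => α i.rev) + Pi.single (Fin.last N) 1

/-- The Schur complement of the last diagonal entry of `lmiMatrix`, as a Hermitian form. -/
def lmiForm (α : Fin (N + 1) → ℝ) (X Y : Matrix (Fin N) (Fin N) ℝ) (ω₀ Ω γ : ℝ)
    (w : Fin (N + 1) → ℂ) : ℝ :=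
  (sesq X (w ∘ Fin.succ) (w ∘ Fin.succ)).re - (sesq X (w ∘ Fin.castSucc) (w ∘ Fin.castSucc)).re
    + bandForm ω₀ Ω Y w - γ ^ 2 * Complex.normSq (w (Fin.last N))
    + Complex.normSq (realDot (ntfVec α) w)

/-- (A, B) is a delay line: from state w₋ and input w_N it moves to the state w₊. -/
theorem matA_mulVec_add_matB_mulVec (w : Fin (N + 1) → ℂ) :
    cplx (matA N) *ᵥ (w ∘ Fin.castSucc) + cplx (matB N) *ᵥ (fun _ => w (Fin.last N)) =
      w ∘ Fin.succ := by
  ext i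
  simp only [Pi.add_apply, mulVec, dotProduct, cplx, matA, matB, Matrix.map_apply, Matrix.of_apply,
    Function.comp, Finset.univ_unique, Finset.sum_singleton]
  rcases Nat.lt_or_ge (i + 1) N with h | h
  · rw [Finset.sum_eq_single ⟨i + 1, h⟩]
    · simp [h.ne]
      rfl
    · intro j _ hj
      rw [if_neg, Complex.ofReal_zero, zero_mul]
      exact fun h' => hj (Fin.ext h'.symm)
    · simp
  · have hi : (i : ℕ) + 1 = N := by omega
    have : i.succ = Fin.last N := Fin.ext (by simpa using hi)
    rw [Finset.sum_eq_zero, this]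
    · simp [hi]
    · intro j _
      rw [if_neg (by omega), Complex.ofReal_zero, zero_mul]

/-- The last entry of `ntfVec` is α₀ + 1, so α₀ = 0 is what makes the feedthrough equal to 1. -/
theorem matC_mulVec_add (α : Fin (N + 1) → ℝ) (hα : α 0 = 0) (w : Fin (N + 1) → ℂ) (k : Fin 1) :
    (cplx (matC α) *ᵥ (w ∘ Fin.castSucc)) k + w (Fin.last N) = realDot (ntfVec α) w := by
  have hrev : ∀ i : Fin N, α (Fin.rev i.castSucc) = α ⟨N - (i : ℕ), by omega⟩ := fun i =>
    congrArg α (Fin.ext (by simp [Fin.rev]))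
  simp only [ntfVec, realDot_add]
  congr 1
  · simp [realDot, mulVec, dotProduct, cplx, matC, Fin.sum_univ_castSucc (n := N), hrev, hα]
  · simp only [realDot, Pi.single_apply, apply_ite Complex.ofReal, Complex.ofReal_one,
      Complex.ofReal_zero, ite_mul, one_mul, zero_mul, Finset.sum_ite_eq', Finset.mem_univ, if_true]

theorem star_dotProduct_cplx_mulVec (M : Matrix m n ℝ) (x : m → ℂ) (y : n → ℂ) :
    star x ⬝ᵥ (cplx M *ᵥ y) = sesq M x y := rfl

theorem star_dotProduct_matM4_mulVec (X Y : Matrix (Fin N) (Fin N) ℝ) (ω₀ Ω : ℝ)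
    (x : Fin N → ℂ) :
    star x ⬝ᵥ (matM4 X Y ω₀ Ω *ᵥ x) =
      sesq X (cplx (matA N) *ᵥ x) (cplx (matA N) *ᵥ x)
        + Complex.exp (-(Complex.I * ω₀)) * sesq Y x (cplx (matA N) *ᵥ x)
        + Complex.exp (Complex.I * ω₀) * sesq Y (cplx (matA N) *ᵥ x) x
        - sesq X x x - (2 * Real.cos Ω : ℝ) * sesq Y x x := by
  simp only [matM4, sub_mulVec, add_mulVec, smul_mulVec, dotProduct_sub, dotProduct_add,
    dotProduct_smul, star_dotProduct_cplx_mulVec, sesq_mul_right, sesq_transpose_left, sesq_smul,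
    smul_eq_mul]

theorem star_dotProduct_matM5_mulVec (X Y : Matrix (Fin N) (Fin N) ℝ) (ω₀ : ℝ)
    (x : Fin N → ℂ) (u : Fin 1 → ℂ) :
    star x ⬝ᵥ (matM5 X Y ω₀ *ᵥ u) =
      sesq X (cplx (matA N) *ᵥ x) (cplx (matB N) *ᵥ u)
        + Complex.exp (-(Complex.I * ω₀)) * sesq Y x (cplx (matB N) *ᵥ u) := by
  simp only [matM5, add_mulVec, smul_mulVec, dotProduct_add,
    dotProduct_smul, star_dotProduct_cplx_mulVec, sesq_mul_right, sesq_transpose_left, smul_eq_mul]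

theorem star_dotProduct_matM5bar_transpose_mulVec {X Y : Matrix (Fin N) (Fin N) ℝ}
    (hX : X.IsSymm) (hY : Y.IsSymm) (ω₀ : ℝ) (x : Fin N → ℂ) (u : Fin 1 → ℂ) :
    star u ⬝ᵥ ((matM5bar X Y ω₀)ᵀ *ᵥ x) =
      sesq X (cplx (matB N) *ᵥ u) (cplx (matA N) *ᵥ x)
        + Complex.exp (Complex.I * ω₀) * sesq Y (cplx (matB N) *ᵥ u) x := by
  simp only [matM5bar, transpose_add, transpose_smul, cplx_transpose, transpose_mul,
    transpose_transpose, hX.eq, hY.eq, add_mulVec, smul_mulVec, dotProduct_add,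
    dotProduct_smul, star_dotProduct_cplx_mulVec, sesq_mul_right, sesq_transpose_left, smul_eq_mul]

theorem star_dotProduct_matM6_mulVec (X : Matrix (Fin N) (Fin N) ℝ) (g : ℝ) (u : Fin 1 → ℂ) :
    star u ⬝ᵥ (matM6 X g *ᵥ u) =
      sesq X (cplx (matB N) *ᵥ u) (cplx (matB N) *ᵥ u) - g * Complex.normSq (u 0) := by
  rw [matM6, star_dotProduct_cplx_mulVec, sesq_sub, sesq_mul_right, sesq_mul_right, sesq_transpose_left,
    sesq_smul, sesq_one]
  simp [Complex.normSq_eq_conj_mul_self]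

/-- Complete the square in the last coordinate: -|s|² + 2 Re(s̄v) = |v|² - |s - v|², with v = C w₋ +
w_N. -/
theorem star_dotProduct_lmiMatrix_mulVec (α : Fin (N + 1) → ℝ) (hα : α 0 = 0)
    {X Y : Matrix (Fin N) (Fin N) ℝ} (hX : X.IsSymm) (hY : Y.IsSymm) (ω₀ Ω γ : ℝ)
    (w : Fin (N + 1) → ℂ) (s : ℂ) :
    star (Sum.elim (Sum.elim (w ∘ Fin.castSucc) fun _ => w (Fin.last N)) fun _ => s) ⬝ᵥ
      (lmiMatrix α X Y ω₀ Ω γ *ᵥ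
        (Sum.elim (Sum.elim (w ∘ Fin.castSucc) fun _ => w (Fin.last N)) fun _ => s)) =
      ((lmiForm α X Y ω₀ Ω γ w - Complex.normSq (s - realDot (ntfVec α) w) : ℝ) : ℂ) := by
  have hhi := matA_mulVec_add_matB_mulVec w
  have hC := matC_mulVec_add α hα w 0
  set x := w ∘ Fin.castSucc with hx
  set u : Fin 1 → ℂ := fun _ => w (Fin.last N) with hu
  set t : Fin 1 → ℂ := fun _ => s with ht
  have hCt : star x ⬝ᵥ ((cplx (matC α).transpose) *ᵥ t) = conj ((cplx (matC α) *ᵥ x) 0) * s := by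
    rw [star_dotProduct_cplx_mulVec, sesq_transpose, sesq]
    simp [ht, dotProduct, mul_comm]
  have hCs : star t ⬝ᵥ ((cplx (matC α)) *ᵥ x) = conj s * (cplx (matC α) *ᵥ x) 0 := by
    simp [ht, dotProduct]
  have hconj : Complex.exp (Complex.I * ω₀) * sesq Y (w ∘ Fin.succ) x =
      conj (Complex.exp (-(Complex.I * ω₀)) * sesq Y x (w ∘ Fin.succ)) := by
    rw [map_mul, ← sesq_transpose, hY.eq, ← conj_exp_I_mul, Complex.conj_conj]
  have hre := Complex.add_conj (Complex.exp (-(Complex.I * ω₀)) * sesq Y x (w ∘ Fin.succ))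
  rw [← hconj] at hre
  have hXhi := sesq_self_eq_ofReal_re hX (w ∘ Fin.succ)
  have hXlo := sesq_self_eq_ofReal_re hX x
  have hYlo := sesq_self_eq_ofReal_re hY x
  have hn1 := Complex.normSq_eq_conj_mul_self (z := s - realDot (ntfVec α) w)
  have hn2 := Complex.normSq_eq_conj_mul_self (z := realDot (ntfVec α) w)
  simp only [lmiMatrix, fromBlocks_mulVec, Function.star_sumElim, Sum.elim_comp_inl,
    Sum.elim_comp_inr, fromRows_mulVec, fromCols_mulVec, sumElim_dotProduct_sumElim,
    ← Sum.elim_add_add, dotProduct_add, one_mulVec, neg_mulVec, dotProduct_neg,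
    star_dotProduct_matM4_mulVec, star_dotProduct_matM5_mulVec,
    star_dotProduct_matM5bar_transpose_mulVec hX hY, star_dotProduct_matM6_mulVec, hCt, hCs]
  have hut : star u ⬝ᵥ t = conj (w (Fin.last N)) * s := by simp [hu, ht, dotProduct]
  have htu : star t ⬝ᵥ u = conj s * w (Fin.last N) := by simp [hu, ht, dotProduct]
  have htt : star t ⬝ᵥ t = conj s * s := by simp [ht, dotProduct]
  set p := cplx (matA N) *ᵥ x
  set q := cplx (matB N) *ᵥ u
  have e1 : sesq X (w ∘ Fin.succ) (w ∘ Fin.succ) =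
      sesq X p p + sesq X p q + (sesq X q p + sesq X q q) := by
    rw [← hhi, sesq_add_left, sesq_add_right, sesq_add_right]
  have e2 : sesq Y x (w ∘ Fin.succ) = sesq Y x p + sesq Y x q := by rw [← hhi, sesq_add_right]
  have e3 : sesq Y (w ∘ Fin.succ) x = sesq Y p x + sesq Y q x := by rw [← hhi, sesq_add_left]
  rw [hut, htu, htt, lmiForm, bandForm, ← hx]
  push_cast at hre ⊢
  rw [hn1, hn2, ← hXhi, ← hXlo, ← hYlo, ← hre, ← hC, e1, e2, e3]
  simp only [map_sub, map_add, hu]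
  ring

theorem isHermitian_lmiMatrix (α : Fin (N + 1) → ℝ) {X Y : Matrix (Fin N) (Fin N) ℝ}
    (hX : X.IsSymm) (hY : Y.IsSymm) (ω₀ Ω γ : ℝ) : (lmiMatrix α X Y ω₀ Ω γ).IsHermitian := by
  have he : star (Complex.exp (Complex.I * ω₀)) = Complex.exp (-(Complex.I * ω₀)) :=
    conj_exp_I_mul ω₀
  have he' : star (Complex.exp (-(Complex.I * ω₀))) = Complex.exp (Complex.I * ω₀) := by
    rw [← he, star_star]
  have h4 : (matM4 X Y ω₀ Ω)ᴴ = matM4 X Y ω₀ Ω := by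
    simp only [matM4, conjTranspose_sub, conjTranspose_add, conjTranspose_smul, he, he',
      cplx_conjTranspose, transpose_mul, transpose_transpose, transpose_smul, hX.eq, hY.eq,
      Matrix.mul_assoc]
    abel
  have h5 : (matM5 X Y ω₀)ᴴ = (matM5bar X Y ω₀)ᵀ := by
    simp only [matM5, matM5bar, conjTranspose_add, conjTranspose_smul, he', cplx_conjTranspose,
      transpose_add, transpose_smul, cplx_transpose]
  have h5' : (matM5bar X Y ω₀)ᵀᴴ = matM5 X Y ω₀ := by rw [← h5, conjTranspose_conjTranspose]
  have h6 : (matM6 X (γ ^ 2))ᴴ = matM6 X (γ ^ 2) := by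
    simp only [matM6, cplx_conjTranspose, transpose_sub, transpose_mul, transpose_smul,
      transpose_one, transpose_transpose, hX.eq, Matrix.mul_assoc]
  rw [Matrix.IsHermitian, lmiMatrix, fromBlocks_conjTranspose, fromBlocks_conjTranspose, h4, h5, h5',
    h6, conjTranspose_fromRows_eq_fromCols_conjTranspose,
    conjTranspose_fromCols_eq_fromRows_conjTranspose, cplx_conjTranspose, cplx_conjTranspose,
    transpose_transpose, conjTranspose_one, conjTranspose_neg, conjTranspose_one]

open scoped ComplexOrder in
theorem negDef_lmiMatrix_iff (α : Fin (N + 1) → ℝ) (hα : α 0 = 0)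
    {X Y : Matrix (Fin N) (Fin N) ℝ} (hX : X.IsSymm) (hY : Y.IsSymm) (ω₀ Ω γ : ℝ) :
    NegDef (lmiMatrix α X Y ω₀ Ω γ) ↔ ∀ w ≠ 0, lmiForm α X Y ω₀ Ω γ w < 0 := by
  have hform := star_dotProduct_lmiMatrix_mulVec α hα hX hY ω₀ Ω γ
  rw [NegDef, posDef_iff_dotProduct_mulVec]
  simp only [neg_mulVec, dotProduct_neg]
  refine ⟨fun h w hw => ?_, fun h => ⟨(isHermitian_lmiMatrix α hX hY ω₀ Ω γ).neg, fun {v} hv => ?_⟩⟩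
  -- This last coordinate makes the completed square vanish.
  · have := h.2 (x := Sum.elim (Sum.elim (w ∘ Fin.castSucc) fun _ => w (Fin.last N))
      fun _ => realDot (ntfVec α) w) (fun h0 => hw ?_)
    · rw [hform, ← Complex.ofReal_neg, Complex.zero_lt_real] at this
      simpa using this
    · ext i
      refine Fin.lastCases ?_ (fun i => ?_) i
      · exact congrFun h0 (Sum.inl (Sum.inr 0))
      · exact congrFun h0 (Sum.inl (Sum.inl i))
  · set w : Fin (N + 1) → ℂ := Fin.snoc (fun i => v (Sum.inl (Sum.inl i))) (v (Sum.inl (Sum.inr 0)))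
    have hvw : v = Sum.elim (Sum.elim (w ∘ Fin.castSucc) fun _ => w (Fin.last N))
        fun _ => v (Sum.inr 0) := by
      ext ((i | i) | i)
      · simp [w]
      · simp [w, Subsingleton.elim i 0]
      · simp [Subsingleton.elim i 0]
    rw [hvw, hform, ← Complex.ofReal_neg, Complex.zero_lt_real, neg_pos, sub_neg]
    -- For w = 0 only -|s|² is left, and s ≠ 0.
    by_cases hw : w = 0
    · have hs : v (Sum.inr 0) ≠ 0 := by
        intro h0
        apply hv
        rw [hvw, hw, h0]
        ext ((i | i) | i) <;> rfl
      simpa [hw, lmiForm, bandForm, sesq, realDot] using hs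
    · exact (h w hw).trans_le (Complex.normSq_nonneg _)

end LMI

/-! ### Both directions of the equivalence -/

section Main

open Polynomial Matrix ComplexConjugate

variable {N : ℕ} {ω₀ Ω γ : ℝ}

theorem realDot_ntfVec_circleVec (α : Fin (N + 1) → ℝ) (ω : ℝ) :
    realDot (ntfVec α) (circleVec N ω) =
      Complex.exp (Complex.I * ω) ^ N * ntf α (Complex.exp (Complex.I * ω)) := by
  have hz : Complex.exp (Complex.I * ω) ≠ 0 := Complex.exp_ne_zero _
  rw [ntfVec, realDot_add, ntf, firFilter, mul_add, mul_one, add_comm, Finset.mul_sum]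
  simp only [realDot, circleVec]
  set z := Complex.exp (Complex.I * ω)
  congr 1
  · simp only [Pi.single_apply, apply_ite Complex.ofReal, Complex.ofReal_one,
      Complex.ofReal_zero, ite_mul, one_mul, zero_mul, Finset.sum_ite_eq', Finset.mem_univ, if_true,
      Fin.val_last]
  · rw [← Equiv.sum_comp Fin.revPerm]
    refine Finset.sum_congr rfl fun i _ => ?_
    have : z ^ N = z ^ (i.rev : ℕ) * z ^ (i : ℕ) := by
      rw [← pow_add, Fin.val_rev]; congr 1; omega
    rw [Fin.revPerm_apply, Fin.rev_rev, this, inv_pow]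
    field_simp

theorem norm_exp_I_mul (ω : ℝ) : ‖Complex.exp (Complex.I * ω)‖ = 1 := by
  rw [mul_comm, Complex.norm_exp_ofReal_mul_I]

theorem normSq_realDot_ntfVec_circleVec (α : Fin (N + 1) → ℝ) (ω : ℝ) :
    Complex.normSq (realDot (ntfVec α) (circleVec N ω)) =
      ‖ntf α (Complex.exp (Complex.I * ω))‖ ^ 2 := by
  rw [realDot_ntfVec_circleVec, Complex.normSq_eq_norm_sq, norm_mul, norm_pow, norm_exp_I_mul,
    one_pow, one_mul]

theorem circleVec_succ (ω : ℝ) : circleVec N ω ∘ Fin.succ =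
    Complex.exp (Complex.I * ω) • (circleVec N ω ∘ Fin.castSucc) := by
  ext i
  simp [circleVec, pow_succ, mul_comm]

theorem sesq_smul_right {m n : Type*} [Fintype m] [Fintype n] (M : Matrix m n ℝ) (c : ℂ)
    (x : m → ℂ) (y : n → ℂ) : sesq M x (c • y) = c * sesq M x y := by
  rw [sesq, mulVec_smul, dotProduct_smul]; rfl

theorem sesq_smul_left {m n : Type*} [Fintype m] [Fintype n] (M : Matrix m n ℝ) (c : ℂ)
    (x : m → ℂ) (y : n → ℂ) : sesq M (c • x) y = conj c * sesq M x y := by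
  rw [sesq, star_smul, smul_dotProduct]; rfl

theorem sesq_self_re_nonneg {n : Type*} [Fintype n] {Y : Matrix n n ℝ} (hY : Y.PosSemidef)
    (x : n → ℂ) : 0 ≤ (sesq Y x x).re := by
  have h : (sesq Y x x).re = (fun i => (x i).re) ⬝ᵥ (Y *ᵥ fun i => (x i).re)
      + (fun i => (x i).im) ⬝ᵥ (Y *ᵥ fun i => (x i).im) := by
    simp only [sesq_eq_sum, Complex.re_sum, Complex.re_ofReal_mul, dotProduct, mulVec,
      ← Finset.sum_add_distrib, Finset.mul_sum]
    refine Finset.sum_congr rfl fun i _ => Finset.sum_congr rfl fun j _ => ?_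
    simp only [Complex.mul_re, Complex.conj_re, Complex.conj_im]
    ring
  rw [h]
  exact add_nonneg (hY.dotProduct_mulVec_nonneg _) (hY.dotProduct_mulVec_nonneg _)

/-- On the circle w₊ = z w₋ with |z| = 1, so X drops out and Y enters with a factor whose sign
detects the band. -/
theorem lmiForm_circleVec (α : Fin (N + 1) → ℝ) {X Y : Matrix (Fin N) (Fin N) ℝ} (hY : Y.IsSymm)
    (ω : ℝ) :
    lmiForm α X Y ω₀ Ω γ (circleVec N ω) =
      2 * (Real.cos (ω - ω₀) - Real.cos Ω) *
          (sesq Y (circleVec N ω ∘ Fin.castSucc) (circleVec N ω ∘ Fin.castSucc)).re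
        - γ ^ 2 + ‖ntf α (Complex.exp (Complex.I * ω))‖ ^ 2 := by
  have h1 : Complex.normSq (circleVec N ω (Fin.last N)) = 1 := by
    rw [Complex.normSq_eq_norm_sq, circleVec, norm_pow, norm_exp_I_mul, one_pow, one_pow]
  have h2 : Complex.exp (-(Complex.I * ω₀)) * Complex.exp (Complex.I * ω) =
      Complex.exp (((ω - ω₀ : ℝ) : ℂ) * Complex.I) := by
    rw [← Complex.exp_add]; push_cast; ring_nf
  rw [lmiForm, bandForm, normSq_realDot_ntfVec_circleVec, h1, circleVec_succ, sesq_smul_right,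
    sesq_smul_left, sesq_smul_right, ← mul_assoc, exp_I_mul_mul_conj, one_mul, ← mul_assoc, h2, sesq_self_eq_ofReal_re hY, Complex.re_mul_ofReal, Complex.exp_ofReal_mul_I_re,
    Complex.ofReal_re]
  ring

theorem norm_ntf_lt_of_lmiForm_neg (α : Fin (N + 1) → ℝ) (hγ : 0 < γ) (hΩ : Ω ≤ Real.pi)
    {X Y : Matrix (Fin N) (Fin N) ℝ} (hY : Y.PosSemidef)
    (h : ∀ w ≠ 0, lmiForm α X Y ω₀ Ω γ w < 0) {ω : ℝ} (hω : |ω - ω₀| ≤ Ω) :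
    ‖ntf α (Complex.exp (Complex.I * ω))‖ < γ := by
  have h0 : circleVec N ω ≠ 0 := fun h0 => by
    have := congrFun h0 0
    simp [circleVec] at this
  have h1 := h _ h0
  have hYs : Y.IsSymm := by simpa [Matrix.IsHermitian, Matrix.IsSymm] using hY.isHermitian
  rw [lmiForm_circleVec α hYs] at h1
  have h2 := sesq_self_re_nonneg hY (circleVec N ω ∘ Fin.castSucc)
  have h3 : Real.cos Ω ≤ Real.cos (ω - ω₀) := by
    rw [← Real.cos_abs (ω - ω₀)]
    exact Real.cos_le_cos_of_nonneg_of_le_pi (abs_nonneg _) hΩ hω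
  have h4 := mul_nonneg (mul_nonneg zero_le_two (sub_nonneg.2 h3)) h2
  exact lt_of_pow_lt_pow_left₀ 2 hγ.le (by linarith)

/-- Bounds the cost of adding a multiple of I to Y: 2 Re(e^{-jω₀} x̄y) ≤ |x|² + |y|², and the cos Ω
term only helps. -/
theorem bandForm_one_le (hΩ : 0 ≤ Real.cos Ω) (w : Fin (N + 1) → ℂ) :
    bandForm ω₀ Ω 1 w ≤ 2 * ∑ i, Complex.normSq (w i) := by
  have hlo : (sesq (1 : Matrix (Fin N) (Fin N) ℝ) (w ∘ Fin.castSucc) (w ∘ Fin.castSucc)).re =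
      ∑ i : Fin N, Complex.normSq (w i.castSucc) := by
    rw [sesq_one, Complex.re_sum]
    refine Finset.sum_congr rfl fun i _ => ?_
    rw [← Complex.normSq_eq_conj_mul_self, Complex.ofReal_re]; rfl
  have h1 : 2 * (Complex.exp (-(Complex.I * ω₀)) *
      sesq (1 : Matrix (Fin N) (Fin N) ℝ) (w ∘ Fin.castSucc) (w ∘ Fin.succ)).re ≤
      ∑ i : Fin N, Complex.normSq (w i.castSucc) + ∑ i : Fin N, Complex.normSq (w i.succ) := by
    rw [sesq_one, Finset.mul_sum, Complex.re_sum, Finset.mul_sum, ← Finset.sum_add_distrib]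
    refine Finset.sum_le_sum fun i _ => ?_
    obtain ⟨he1, he2⟩ := exp_neg_I_mul_re_im ω₀
    simp only [Function.comp, Complex.mul_re, Complex.mul_im, Complex.conj_re, Complex.conj_im,
      Complex.normSq_apply, he1, he2]
    set x := w i.castSucc
    set y := w i.succ
    have e4 := Real.sin_sq_add_cos_sq ω₀
    have key : 0 ≤ (x.re - (Real.cos ω₀ * y.re + Real.sin ω₀ * y.im)) ^ 2 +
      (x.im - (Real.cos ω₀ * y.im - Real.sin ω₀ * y.re)) ^ 2 := by positivity
    linarith [congrArg (fun t => (y.re ^ 2 + y.im ^ 2) * t) e4]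
  have h2 : ∑ i : Fin N, Complex.normSq (w i.castSucc) ≤ ∑ i, Complex.normSq (w i) := by
    rw [Fin.sum_univ_castSucc]
    exact le_add_of_nonneg_right (Complex.normSq_nonneg _)
  have h3 : ∑ i : Fin N, Complex.normSq (w i.succ) ≤ ∑ i, Complex.normSq (w i) := by
    rw [Fin.sum_univ_succ]
    exact le_add_of_nonneg_left (Complex.normSq_nonneg _)
  have h4 : 0 ≤ 2 * Real.cos Ω * ∑ i : Fin N, Complex.normSq (w i.castSucc) :=
    mul_nonneg (by linarith) (Finset.sum_nonneg fun i _ => Complex.normSq_nonneg _)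
  rw [bandForm, hlo]
  linarith

theorem sesq_one_self_re (w : Fin (N + 1) → ℂ) :
    (sesq (1 : Matrix (Fin (N + 1)) (Fin (N + 1)) ℝ) w w).re = ∑ i, Complex.normSq (w i) := by
  rw [sesq_one, Complex.re_sum]
  refine Finset.sum_congr rfl fun i _ => ?_
  rw [← Complex.normSq_eq_conj_mul_self, Complex.ofReal_re]

theorem sesq_one_circleVec (ω : ℝ) :
    sesq (1 : Matrix (Fin (N + 1)) (Fin (N + 1)) ℝ) (circleVec N ω) (circleVec N ω) =
      ((N + 1 : ℝ) : ℂ) := by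
  rw [sesq_one]
  have : ∀ i : Fin (N + 1), conj (circleVec N ω i) * circleVec N ω i = 1 := fun i => by
    rw [circleVec, map_pow, ← mul_pow, mul_comm, exp_I_mul_mul_conj, one_pow]
  simp [this]

theorem sum_normSq_pos {w : Fin (N + 1) → ℂ} (hw : w ≠ 0) : 0 < ∑ i, Complex.normSq (w i) := by
  obtain ⟨i, hi⟩ := Function.ne_iff.1 hw
  exact Finset.sum_pos' (fun i _ => Complex.normSq_nonneg _)
    ⟨i, Finset.mem_univ _, Complex.normSq_pos.2 hi⟩

theorem exists_lmiForm_neg (α : Fin (N + 1) → ℝ) (hω₀ : ω₀ ∈ Set.Ioo 0 Real.pi) (hΩ : 0 < Ω)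
    (hl : Ω ≤ ω₀) (hr : ω₀ + Ω ≤ Real.pi) {c : ℝ} (hc : 0 ≤ c) (hcγ : c < γ)
    (hband : ∀ ω ∈ Set.Icc (ω₀ - Ω) (ω₀ + Ω), ‖ntf α (Complex.exp (Complex.I * ω))‖ ≤ c) :
    ∃ X Y : Matrix (Fin N) (Fin N) ℝ, X.IsSymm ∧ Y.PosDef ∧
      ∀ w ≠ 0, lmiForm α X Y ω₀ Ω γ w < 0 := by
  -- On the band p ≥ 2ε: half keeps p - ε strictly positive, the other half becomes the slack δI.
  set ε := (γ ^ 2 - c ^ 2) / 2 with hε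
  have hε0 : 0 < ε := half_pos (sub_pos.2 (pow_lt_pow_left₀ hcγ hc two_ne_zero))
  set e : Fin (N + 1) → ℝ := Pi.single (Fin.last N) 1
  have hedot : ∀ w, realDot e w = w (Fin.last N) := fun w => by
    simp only [e, realDot, Pi.single_apply, apply_ite Complex.ofReal, Complex.ofReal_one,
      Complex.ofReal_zero, ite_mul, one_mul, zero_mul, Finset.sum_ite_eq', Finset.mem_univ, if_true]
  set T : Matrix (Fin (N + 1)) (Fin (N + 1)) ℝ :=
    γ ^ 2 • vecMulVec e e - vecMulVec (ntfVec α) (ntfVec α) with hT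
  have hTs : T.IsSymm := ((isSymm_vecMulVec_self e).smul _).sub (isSymm_vecMulVec_self _)
  have hTform : ∀ w, (sesq T w w).re = γ ^ 2 * Complex.normSq (w (Fin.last N)) -
      Complex.normSq (realDot (ntfVec α) w) := fun w => by
    rw [hT, sesq_sub, sesq_smul, sesq_vecMulVec, sesq_vecMulVec, hedot,
      ← Complex.normSq_eq_conj_mul_self, ← Complex.normSq_eq_conj_mul_self]
    norm_cast
  obtain ⟨p, hpdeg, hp⟩ := exists_symbol_polynomial hTs
  have hpval : ∀ ω : ℝ, p.eval (Real.cos ω) = γ ^ 2 - ‖ntf α (Complex.exp (Complex.I * ω))‖ ^ 2 := by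
    intro ω
    have h1 := hTform (circleVec N ω)
    have h2 : Complex.normSq (circleVec N ω (Fin.last N)) = 1 := by
      rw [Complex.normSq_eq_norm_sq, circleVec, norm_pow, norm_exp_I_mul, one_pow, one_pow]
    rwa [hp, Complex.ofReal_re, h2, normSq_realDot_ntfVec_circleVec, mul_one] at h1
  have hpos : ∀ x ∈ Set.Icc (Real.cos (ω₀ + Ω)) (Real.cos (ω₀ - Ω)), 0 < (p - C ε).eval x := by
    intro x hx
    have hx1 : Real.cos (Real.arccos x) = x :=
      Real.cos_arccos ((Real.neg_one_le_cos _).trans hx.1) (hx.2.trans (Real.cos_le_one _))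
    have hmem : Real.arccos x ∈ Set.Icc (ω₀ - Ω) (ω₀ + Ω) := by
      constructor
      · rw [← Real.arccos_cos (show 0 ≤ ω₀ - Ω by linarith) (by linarith)]
        exact Real.arccos_le_arccos hx.2
      · rw [← Real.arccos_cos (show 0 ≤ ω₀ + Ω by linarith) hr]
        exact Real.arccos_le_arccos hx.1
    have h1 := pow_le_pow_left₀ (norm_nonneg _) (hband _ hmem) 2
    rw [eval_sub, eval_C, ← hx1, hpval]
    linarith
  have hAB : Real.cos (ω₀ + Ω) < Real.cos (ω₀ - Ω) :=
    Real.cos_lt_cos_of_nonneg_of_le_pi (by linarith) hr (by linarith)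
  have hdeg : (p - C ε).natDegree ≤ N := (natDegree_sub_C).le.trans hpdeg
  obtain ⟨Θ, Y, hΘ, hY, hsym, hform⟩ := bandCert_of_mem_intervalCone hω₀ hΩ hl hr
    (mem_intervalCone_of_pos hAB N _ hdeg hpos)
  have hN : (0 : ℝ) < N + 1 := by positivity
  -- The identity has symbol N + 1, so δI has symbol ε and T - Θ - δI has symbol zero.
  set δ := ε / (N + 1) with hδ
  have hδ0 : 0 < δ := div_pos hε0 hN
  obtain ⟨X, hX, hdisp⟩ := exists_displacement (K := T - Θ - δ • 1)
    ((hTs.sub hΘ).sub (Matrix.isSymm_one.smul _)) (fun ω => by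
      rw [sesq_sub, sesq_sub, sesq_smul, hp, hsym, sesq_one_circleVec, ← Complex.ofReal_mul,
        ← Complex.ofReal_sub, ← Complex.ofReal_sub, hδ, div_mul_cancel₀ _ hN.ne']
      simp)
  -- The displacement is X₋ - X₊ while `lmiForm` contains X₊ - X₋, hence the sign. The shift by δ/4
  -- costs at most (δ/2)‖w‖² out of the available δ‖w‖².
  refine ⟨-X, Y + (δ / 4) • 1, hX.neg,
    Matrix.PosDef.posSemidef_add hY (Matrix.PosDef.one.smul (by positivity)), fun w hw => ?_⟩
  have h1 := congrArg Complex.re (hdisp w)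
  rw [sesq_sub, sesq_sub, sesq_smul, Complex.sub_re, Complex.sub_re, Complex.sub_re,
    Complex.re_ofReal_mul, sesq_one_self_re, hTform] at h1
  have hcos : 0 ≤ Real.cos Ω :=
    Real.cos_nonneg_of_neg_pi_div_two_le_of_le (by linarith [Real.pi_pos]) (by linarith)
  have h2 := mul_le_mul_of_nonneg_left (bandForm_one_le (ω₀ := ω₀) hcos w)
    (show 0 ≤ δ / 4 by positivity)
  have h3 := hform w
  have h4 := mul_pos hδ0 (sum_normSq_pos hw)
  rw [← neg_one_smul ℝ X, lmiForm, sesq_smul, sesq_smul, Complex.re_ofReal_mul,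
    Complex.re_ofReal_mul, bandForm_add, bandForm_smul]
  linarith

theorem bandwidth_le (hband : Set.Icc (ω₀ - Ω) (ω₀ + Ω) ⊆ Set.Icc 0 Real.pi) (hΩ : 0 < Ω) :
    Ω ≤ ω₀ ∧ ω₀ + Ω ≤ Real.pi :=
  ⟨sub_nonneg.1 (hband (Set.left_mem_Icc.2 (by linarith))).1,
    (hband (Set.right_mem_Icc.2 (by linarith))).2⟩

end Main

end

theorem theorem2 (N : ℕ) (α : Fin (N + 1) → ℝ) (hα : α 0 = 0)
    (ω₀ Ω γ : ℝ) (hω₀ : ω₀ ∈ Set.Ioo 0 Real.pi) (hΩ : 0 < Ω)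
    (hband : Set.Icc (ω₀ - Ω) (ω₀ + Ω) ⊆ Set.Icc 0 Real.pi) (hγ : 0 < γ) :
    worstCase (ntf α) (Set.Icc (ω₀ - Ω) (ω₀ + Ω)) < γ ↔
      ∃ X Y : Matrix (Fin N) (Fin N) ℝ,
        X.IsSymm ∧ Y.PosDef ∧ NegDef (lmiMatrix α X Y ω₀ Ω γ) := by
  obtain ⟨hl, hr⟩ := bandwidth_le hband hΩ
  have hsymm : ∀ {Y : Matrix (Fin N) (Fin N) ℝ}, Y.PosDef → Y.IsSymm := fun hY => by
    simpa [Matrix.IsHermitian, Matrix.IsSymm] using hY.isHermitian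
  -- Attainment at ω₁ lets the pointwise strict bound give the bound on the maximum; conversely the
  -- maximum itself serves as the uniform bound c < γ.
  obtain ⟨⟨ω₁, hω₁, hmax⟩, hle⟩ := isGreatest_worstCase_ntf α (Set.Icc (ω₀ - Ω) (ω₀ + Ω)) isCompact_Icc
    (Set.nonempty_Icc.2 (by linarith))
  constructor
  · intro h
    obtain ⟨X, Y, hX, hY, hneg⟩ := exists_lmiForm_neg α hω₀ hΩ hl hr
      (hmax ▸ norm_nonneg _) h fun ω hω => hle ⟨ω, hω, rfl⟩
    exact ⟨X, Y, hX, hY, (negDef_lmiMatrix_iff α hα hX (hsymm hY) ω₀ Ω γ).2 hneg⟩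
  · rintro ⟨X, Y, hX, hY, hneg⟩
    rw [← hmax]
    refine norm_ntf_lt_of_lmiForm_neg α hγ (by linarith [hω₀.2]) hY.posSemidef
      ((negDef_lmiMatrix_iff α hα hX (hsymm hY) ω₀ Ω γ).1 hneg) ?_
    rw [abs_le]
    constructor <;> linarith [hω₁.1, hω₁.2]
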